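/- Let $\Pi=\{z\in\mathbb C:\operatorname{Im}z>0\}$, let $\tau\in\mathbb R$, and let $\gamma:[0,\infty)\to[0,\infty)$ be monotone increasing with $\gamma(t)=O(t^2)$ as $t\to0^+$. **Definitions.** For an analytic function $f:\Pi\to\overline\Pi$, its Nevanlinna measure $\mu_f$ is the locally finite Borel measure on $\mathbb R$ that is the weak limit (against continuous compactly supported functions) of the measures $\operatorname{Im}f(x+iy)\,dx$ as $y\to0^+$. The function $f$ is $\gamma$-regular (at $\tau$) if there is $C>0$ such that $1/\gamma(C|t-\tau|)$ (with $1/0=\infty$) is $\mu_f$-integrable on a neighborhood of $\tau$. The Julia quotient of $f$ is $J_f(z)=\operatorname{dist}(f(z),\partial\Pi)/\operatorname{dist}(z,\partial\Pi)=\operatorname{Im}f(z)/\operatorname{Im}z$. For $\lambda:[0,\infty)\to[0,\infty)$ the $\lambda$-Stolz region at $\tau$ is $$S^\lambda_\tau=\{z\in\Pi:\ \operatorname{Im}z\ge\lambda(c)\text{ and }|\operatorname{Re}z-\tau|\le c\text{ for some }c>0\},$$ and the amortized Julia quotient $AJ^\tau_{f,\lambda}(d)$, $d>0$, is the average of $J_f$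 with respect to arclength over $C_d=\{z\in\Pi:\operatorname{Im}z=\lambda(d),\ |\operatorname{Re}z-\tau|\le d\}$ (taken to be $0$ if $\lambda(d)=0$, when $C_d$ is empty). **Theorem.** 1. For every $\gamma$-regular analytic $f:\Pi\to\overline\Pi$ there is $C>0$ such that for every $D>0$ the quotient $J_f(z)$ is bounded on $S^{\sqrt{D\gamma(Ct)}}_\tau$ as $z\to\tau$, that is, on the intersection of this region with some neighborhood of $\tau$. 2. For every $\gamma$-regular analytic $f:\Pi\to\overline\Pi$ there is $C>0$ such that $AJ^\tau_{f,\gamma(Ct)/(Ct)}(d)$ is bounded as $d\to0^+$. Moreover, with the same $C$: for every $\lambda:[0,\infty)\to[0,\infty)$ for which $AJ^\tau_{f,\lambda}(d)$ is bounded as $d\to0^+$, $AJ^\tau_{f,\min(\gamma(Ct)/(Ct),\lambda)}(d)$ is also bounded as $d\to0^+$. 3. Suppose in addition that $\gamma(t)>0$ for all $t>0$. Let $\lambda:[0,\infty)\to[0,\infty)$ satisfy $\lambda(t)=o\big(\sqrt{B\gamma(Ct)}\big)$ as $t\to0^+$ for some $B,C>0$. Then there is a $\gamma$-regular analytic $f:\Pi\to\overline\Pi$,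 of the form $f(z)=\sum_{n}\frac{m_n}{p_n-z}$ with $p_n\in\mathbb R$, $m_n>0$ and $\sum_n m_n<\infty$, such that $J_f(z)$ is unbounded on $S^\lambda_\tau$ as $z\to\tau$, that is, unbounded on the intersection of this region with every neighborhood of $\tau$. -/

import Mathlib

open Set Filter Topology MeasureTheory Asymptotics
open scoped ENNReal

noncomputable section

namespace PickJulia

/-- The open upper half plane `Π` as a subset of `ℂ`. -/
abbrev halfPlane : Set ℂ := UpperHalfPlane.upperHalfPlaneSet

/-- The Julia quotient `J_f(z) = dist(f z, ∂Ω) / dist(z, ∂D)`. -/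
def juliaQuotient (D Ω : Set ℂ) (f : ℂ → ℂ) (z : ℂ) : ℝ :=
  Metric.infDist (f z) (frontier Ω) / Metric.infDist z (frontier D)

/-- The tangential distance `√(dist(z, τ)² - dist(z, ∂D)²)` of `z` to `τ`. -/
def tangentialDist (D : Set ℂ) (τ z : ℂ) : ℝ :=
  √(dist z τ ^ 2 - Metric.infDist z (frontier D) ^ 2)

/-- The `lam`-Stolz region in `D` at the boundary point `τ`. -/
def stolzRegion (D : Set ℂ) (lam : ℝ → ℝ) (τ : ℂ) : Set ℂ :=
  {z | z ∈ D ∧ ∃ C : ℝ, 0 < C ∧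
    lam C ≤ Metric.infDist z (frontier D) ∧ tangentialDist D τ z ≤ C}

/-- The arc `C_d` of points of `D` at distance exactly `lam d` from `∂D` and at tangential distance
at most `d` from `τ`. -/
def stolzArc (D : Set ℂ) (lam : ℝ → ℝ) (τ : ℂ) (d : ℝ) : Set ℂ :=
  {z | z ∈ D ∧ Metric.infDist z (frontier D) = lam d ∧ tangentialDist D τ z ≤ d}

/-- The amortized Julia quotient: the mean value of `J_f` over the arc `C_d` with respect to
arclength (one-dimensional Hausdorff measure). -/
def amortizedJuliaQuotient (D Ω : Set ℂ) (f : ℂ → ℂ) (lam : ℝ → ℝ) (τ : ℂ) (d : ℝ) : ℝ :=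
  ⨍ z in stolzArc D lam τ d, juliaQuotient D Ω f z ∂(Measure.hausdorffMeasure 1 : Measure ℂ)

/-- `f` is (the extension by arbitrary values of) an analytic function from the upper half plane to
the closed upper half plane. -/
structure IsPick (f : ℂ → ℂ) : Prop where
  analytic : AnalyticOnNhd ℂ f halfPlane
  mapsTo : MapsTo f halfPlane (closure halfPlane)

/-- `μ` is the Nevanlinna measure of `f`: the weak limit, against continuous compactly supported
test functions, of the measures `Im f(x + iy) dx` as `y` decreases to `0`. -/
structure IsNevanlinnaMeasure (f : ℂ → ℂ) (μ : Measure ℝ) : Prop where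
  locallyFinite : IsLocallyFiniteMeasure μ
  tendsto : ∀ g : ℝ → ℝ, Continuous g → HasCompactSupport g →
    Tendsto (fun y : ℝ => ∫ x : ℝ, g x * (f (x + y * Complex.I)).im) (𝓝[>] 0) (𝓝 (∫ x, g x ∂μ))

/-- `f` is `γ`-regular at `τ`: for some `C > 0` the function `t ↦ 1 / γ (C |t - τ|)`, with
`1 / 0 = ∞`, is integrable on a neighborhood of `τ` for the Nevanlinna measure of `f`. -/
def IsRegularAt (γ : ℝ → ℝ) (τ : ℝ) (f : ℂ → ℂ) : Prop :=
  ∃ μ : Measure ℝ, IsNevanlinnaMeasure f μ ∧ ∃ C : ℝ, 0 < C ∧ ∃ U ∈ 𝓝 τ,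
    ∫⁻ t in U, (ENNReal.ofReal (γ (C * |t - τ|)))⁻¹ ∂μ < ∞

theorem mem_halfPlane {z : ℂ} : z ∈ halfPlane ↔ 0 < z.im := Iff.rfl

theorem frontier_halfPlane : frontier halfPlane = {z : ℂ | z.im = 0} :=
  Complex.frontier_setOfPred_lt_im 0

theorem closure_halfPlane : closure halfPlane = {z : ℂ | 0 ≤ z.im} :=
  Complex.closure_setOfPred_lt_im 0

theorem infDist_frontier_halfPlane (z : ℂ) : Metric.infDist z (frontier halfPlane) = |z.im| := by
  rw [frontier_halfPlane]
  apply le_antisymm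
  · have h : ((z.re : ℝ) : ℂ) ∈ {w : ℂ | w.im = 0} := by simp
    refine (Metric.infDist_le_dist_of_mem h).trans (le_of_eq ?_)
    rw [Complex.dist_of_re_eq (by simp)]
    simp
  · refine (Metric.le_infDist ⟨0, by simp⟩).2 ?_
    intro w hw
    have h := Complex.abs_im_le_norm (z - w)
    rw [Complex.sub_im, show w.im = 0 from hw, sub_zero] at h
    rwa [dist_eq_norm]

theorem tangentialDist_halfPlane (τ : ℝ) (z : ℂ) :
    tangentialDist halfPlane τ z = |z.re - τ| := by
  rw [tangentialDist, infDist_frontier_halfPlane, Complex.dist_eq, Complex.sq_norm,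
    Complex.normSq_apply, sq_abs, ← Real.sqrt_sq_eq_abs (z.re - τ)]
  congr 1
  simp only [Complex.sub_re, Complex.sub_im, Complex.ofReal_re, Complex.ofReal_im]
  ring

theorem juliaQuotient_halfPlane {f : ℂ → ℂ} (hf : IsPick f) {z : ℂ} (hz : 0 < z.im) :
    juliaQuotient halfPlane halfPlane f z = (f z).im / z.im := by
  have h : 0 ≤ (f z).im := by
    have := hf.mapsTo (mem_halfPlane.2 hz)
    rwa [closure_halfPlane] at this
  rw [juliaQuotient, infDist_frontier_halfPlane, infDist_frontier_halfPlane, abs_of_nonneg h,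
    abs_of_pos hz]

theorem mem_stolzRegion_halfPlane {lam : ℝ → ℝ} {τ : ℝ} {z : ℂ} :
    z ∈ stolzRegion halfPlane lam τ ↔
      0 < z.im ∧ ∃ C : ℝ, 0 < C ∧ lam C ≤ z.im ∧ |z.re - τ| ≤ C := by
  simp only [stolzRegion, mem_ofPred_eq, infDist_frontier_halfPlane,
    tangentialDist_halfPlane]
  refine and_congr_right fun h => ?_
  rw [abs_of_pos h]

theorem stolzArc_halfPlane {lam : ℝ → ℝ} {τ d : ℝ} (hl : 0 < lam d) :
    stolzArc halfPlane lam τ d =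
      (fun x : ℝ => (x + lam d * Complex.I : ℂ)) '' Icc (τ - d) (τ + d) := by
  ext z
  simp only [stolzArc, mem_ofPred_eq, infDist_frontier_halfPlane,
    tangentialDist_halfPlane, mem_image, mem_Icc]
  constructor
  · rintro ⟨h0, h1, h2⟩
    rw [abs_of_pos h0] at h1
    rw [abs_le] at h2
    refine ⟨z.re, ⟨by linarith, by linarith⟩, ?_⟩
    rw [← h1, Complex.re_add_im]
  · rintro ⟨x, ⟨h1, h2⟩, rfl⟩
    have e1 : (x + lam d * Complex.I : ℂ).im = lam d := by simp
    have e2 : (x + lam d * Complex.I : ℂ).re = x := by simp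
    rw [e1, e2, abs_of_pos hl, abs_le]
    exact ⟨hl, rfl, by linarith, by linarith⟩

/-- In the upper half plane the amortized Julia quotient is a mean over a horizontal segment. -/
theorem amortizedJuliaQuotient_halfPlane {f : ℂ → ℂ} (hf : IsPick f) {lam : ℝ → ℝ} {τ d : ℝ}
    (hd : 0 < d) (hl : 0 < lam d) :
    amortizedJuliaQuotient halfPlane halfPlane f lam τ d =
      (2 * d)⁻¹ * ∫ x in Icc (τ - d) (τ + d), (f (x + lam d * Complex.I)).im / lam d := by
  have he : Isometry (fun x : ℝ => (x + lam d * Complex.I : ℂ)) :=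
    Isometry.of_dist_eq fun x y => by simp [dist_eq_norm, ← Complex.ofReal_sub]
  have hm : MeasurableEmbedding (fun x : ℝ => (x + lam d * Complex.I : ℂ)) :=
    he.isClosedEmbedding.measurableEmbedding
  have h1 : ((Measure.hausdorffMeasure 1 : Measure ℂ).restrict (stolzArc halfPlane lam τ d)) =
      (volume.restrict (Icc (τ - d) (τ + d))).map (fun x : ℝ => (x + lam d * Complex.I : ℂ)) := by
    rw [stolzArc_halfPlane hl, ← hausdorffMeasure_real]
    have hp : Icc (τ - d) (τ + d) = (fun x : ℝ => (x + lam d * Complex.I : ℂ)) ⁻¹'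
        ((fun x : ℝ => (x + lam d * Complex.I : ℂ)) '' Icc (τ - d) (τ + d)) :=
      (preimage_image_eq _ he.injective).symm
    conv_rhs => rw [hp]
    rw [← hm.restrict_map, he.map_hausdorffMeasure (Or.inl zero_le_one),
      Measure.restrict_restrict (hm.measurableSet_image.2 measurableSet_Icc),
      inter_eq_self_of_subset_left (image_subset_range _ _)]
  have h2 : (Measure.hausdorffMeasure 1 : Measure ℂ).real (stolzArc halfPlane lam τ d) = 2 * d := by
    rw [← measureReal_restrict_apply_univ, h1, Measure.real, hm.map_apply, preimage_univ,
      Measure.restrict_apply_univ, Real.volume_Icc, ENNReal.toReal_ofReal (by linarith)]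
    ring
  rw [amortizedJuliaQuotient, setAverage_eq, h2, h1, hm.integral_map, smul_eq_mul]
  congr 1
  refine integral_congr_ae (Eventually.of_forall fun x => ?_)
  have e1 : (x + lam d * Complex.I : ℂ).im = lam d := by simp
  simp only
  rw [juliaQuotient_halfPlane hf (by rw [e1]; exact hl), e1]

end PickJulia

end

/-! Near `τ` the Julia quotient at `x + iy` is at most a constant plus `∫ dμ(t) / ((x - t)² + y²)`
over a compact interval around `τ`, where `μ` is the Nevanlinna measure (`IsPick.exists_im_le`).
Only this upper bound is needed, so the full Nevanlinna representation is bypassed. The Poisson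
formula is applied on discs of radius `R` tangent to the real line. The part of the circle away from
the tangency point is dominated, uniformly in `R`, by a multiple of the height times the value at
`i`. Then `R → ∞` flattens the near arc to a segment. Shifting `f` up by `ε` makes this legitimate,
and `ε → 0` brings in `μ`.

Both upper bounds compare the kernel with `1 / γ(c|t - τ|)`, which is integrable. For `t` far from
`τ` relative to the region considered, the kernel is at most `4 / |t - τ|²`, and `γ(t) = O(t²)`
suffices. For near `t`, `|t - τ| ≤ 2s`, monotonicity bounds `γ(c|t - τ|)` by `γ(2cs)`: on the
square-root Stolz region the kernel is at most `1 / y² ≤ 1 / (D γ(2cs))`. For the amortized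
quotient, Tonelli allows integration in `x` first, and the full Poisson mass `π / y` replaces `1 /
y²`; this is why height `γ(Ct) / (Ct)` is enough.

For sharpness, masses `2⁻ⁿ γ(C tₙ)` sit at `τ + tₙ`, so the regularity integral is a geometric
series. At height `yₙ = 2⁻ⁿ √(B γ(C tₙ))` above the `n`-th pole that pole alone contributes `mₙ /
yₙ² = 2ⁿ / B`, while the little-o hypothesis places the point in the Stolz region. -/

noncomputable section

namespace PickJulia

open Real

/-! ### Poisson integrals on discs tangent to the real line -/

/-- The point at angle `φ` from `0` on the circle of radius `R` tangent to the real line at `0`. -/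
def horocycle (R φ : ℝ) : ℂ := ⟨R * sin φ, R * (1 - cos φ)⟩

theorem circleMap_eq_horocycle (R φ : ℝ) :
    circleMap (R * Complex.I) R (φ - π / 2) = horocycle R φ := by
  apply Complex.ext
  · simp [circleMap, horocycle, Complex.exp_re, Real.cos_sub_pi_div_two]
  · simp [circleMap, horocycle, Complex.exp_im, Real.sin_sub_pi_div_two]
    ring

theorem continuous_horocycle (R : ℝ) : Continuous (horocycle R) := by
  have : horocycle R = fun φ => circleMap (R * Complex.I) R (φ - π / 2) :=
    funext fun φ => (circleMap_eq_horocycle R φ).symm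
  rw [this]
  exact (continuous_circleMap _ _).comp (by fun_prop)

theorem horocycle_im_nonneg {R : ℝ} (hR : 0 ≤ R) (φ : ℝ) : 0 ≤ (horocycle R φ).im :=
  mul_nonneg hR (by linarith [cos_le_one φ])

theorem sq_norm_horocycle (R φ : ℝ) : ‖horocycle R φ‖ ^ 2 = 2 * R ^ 2 * (1 - cos φ) := by
  rw [Complex.sq_norm, Complex.normSq_apply]
  simp only [horocycle]
  linear_combination R ^ 2 * sin_sq_add_cos_sq φ

/-- Follows from `1 - cos φ ≥ 2φ² / π² ≥ φ² / 8`. It keeps angles `|φ| ≥ δ / R` at distance at least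
`δ / 2` from the tangency point, whatever `R` is. -/
theorem le_norm_horocycle {R φ : ℝ} (hφ : |φ| ≤ π) :
    R * |φ| / 2 ≤ ‖horocycle R φ‖ := by
  have h := cos_le_one_sub_mul_cos_sq hφ
  have hp : (1 : ℝ) / 8 ≤ 2 / π ^ 2 := by
    rw [div_le_div_iff₀ (by norm_num) (by positivity)]
    nlinarith [pi_pos, pi_le_four]
  refine abs_le_of_sq_le_sq' ?_ (norm_nonneg _) |>.2
  rw [sq_norm_horocycle, div_pow, mul_pow, sq_abs]
  have : 1 / 8 * φ ^ 2 ≤ 1 - cos φ := by nlinarith [sq_nonneg φ]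
  nlinarith [sq_nonneg R]

theorem norm_horocycle_sub (R φ : ℝ) : ‖horocycle R φ - R * Complex.I‖ = |R| := by
  rw [← circleMap_eq_horocycle]
  simp

theorem poissonKernel_horocycle (R φ : ℝ) (z : ℂ) :
    poissonKernel (R * Complex.I) z (horocycle R φ) =
      (2 * R * z.im - ‖z‖ ^ 2) / ‖horocycle R φ - z‖ ^ 2 := by
  rw [poissonKernel_def, norm_horocycle_sub, sub_sub_sub_cancel_right, sq_abs]
  congr 1
  simp only [Complex.sq_norm, Complex.normSq_apply]
  simp
  ring

theorem mem_ball_horocycle {R : ℝ} (hR : 0 < R) {z : ℂ} :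
    z ∈ Metric.ball (R * Complex.I) R ↔ ‖z‖ ^ 2 < 2 * R * z.im := by
  rw [Metric.mem_ball, dist_eq_norm, ← sq_lt_sq₀ (norm_nonneg _) hR.le]
  simp only [Complex.sq_norm, Complex.normSq_apply]
  simp
  constructor <;> intro h <;> nlinarith

section

variable {F : ℂ → ℂ} {ε : ℝ}

theorem continuous_comp_horocycle (hε : 0 < ε) (hF : DifferentiableOn ℂ F {w | -ε < w.im})
    {R : ℝ} (hR : 0 < R) : Continuous fun φ => F (horocycle R φ) := by
  refine hF.continuousOn.comp_continuous (continuous_horocycle R) fun φ => ?_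
  have := horocycle_im_nonneg hR.le φ
  show -ε < _
  linarith

theorem horocycle_ne {R : ℝ} (hR : 0 < R) {z : ℂ} (hz : ‖z‖ ^ 2 < 2 * R * z.im) (φ : ℝ) :
    horocycle R φ - z ≠ 0 := by
  intro h
  rw [sub_eq_zero] at h
  have h1 := (mem_ball_horocycle hR).2 hz
  rw [← h, Metric.mem_ball, dist_eq_norm, norm_horocycle_sub, abs_of_pos hR] at h1
  exact lt_irrefl _ h1

/-- The Poisson integral formula on the disc of radius `R` tangent to the real line at `0`. -/
theorem im_eq_integral_horocycle (hε : 0 < ε) (hF : DifferentiableOn ℂ F {w | -ε < w.im})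
    {R : ℝ} (hR : 0 < R) {z : ℂ} (hz : ‖z‖ ^ 2 < 2 * R * z.im) :
    (F z).im = (2 * π)⁻¹ * ∫ φ in -π..π,
      (2 * R * z.im - ‖z‖ ^ 2) / ‖horocycle R φ - z‖ ^ 2 * (F (horocycle R φ)).im := by
  have hd : DiffContOnCl ℂ F (Metric.ball (R * Complex.I) R) := by
    refine (hF.mono ?_).diffContOnCl
    rw [closure_ball _ hR.ne']
    intro w hw
    rw [Metric.mem_closedBall, dist_eq_norm] at hw
    have h1 := Complex.abs_im_le_norm (w - R * Complex.I)
    simp at h1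
    have := (abs_le.1 (h1.trans hw)).1
    show -ε < _
    linarith
  have h := hd.circleAverage_poissonKernel_smul ((mem_ball_horocycle hR).2 hz)
  rw [Real.circleAverage_def] at h
  set G : ℝ → ℂ := fun φ => (poissonKernel (R * Complex.I) z • F) (circleMap (R * Complex.I) R φ)
    with hG
  have hper : Function.Periodic G (2 * π) := fun φ => by
    simp only [hG, (periodic_circleMap _ _ φ)]
  -- The integral over a full period is independent of its starting point; the quarter turn puts
  -- angle `0` at the tangency point.
  have h1 : ∫ φ in (0:ℝ)..2 * π, G φ = ∫ φ in -π..π, G (φ - π / 2) := by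
    rw [intervalIntegral.integral_comp_sub_right (fun φ => G φ)]
    have := hper.intervalIntegral_add_eq 0 (-π - π / 2)
    rw [zero_add] at this
    rw [this]
    congr 1
    ring
  have h2 : ∀ φ, G (φ - π / 2) = (((2 * R * z.im - ‖z‖ ^ 2) / ‖horocycle R φ - z‖ ^ 2 : ℝ) : ℂ) *
      F (horocycle R φ) := fun φ => by
    simp only [hG, Pi.smul_apply', circleMap_eq_horocycle, poissonKernel_horocycle,
      Complex.real_smul]
  have hc : Continuous fun φ => G (φ - π / 2) := by
    simp only [h2]
    refine Continuous.mul (Complex.continuous_ofReal.comp ?_) (continuous_comp_horocycle hε hF hR)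
    refine continuous_const.div (((continuous_horocycle R).sub continuous_const).norm.pow 2) ?_
    exact fun φ => pow_ne_zero _ (norm_ne_zero_iff.2 (horocycle_ne hR hz φ))
  rw [h1] at h
  have h3 := Complex.imCLM.intervalIntegral_comp_comm (hc.intervalIntegrable (μ := volume) (-π) π)
  rw [← h, Complex.smul_im, smul_eq_mul]
  simp only [Complex.imCLM_apply] at h3
  rw [← h3]
  congr 2
  funext φ
  rw [h2, Complex.im_ofReal_mul]

/-- A Harnack-type comparison of the kernels at `z` and at `i`. Away from the tangency point both
distances are comparable with `‖ζ‖`, and the numerators are comparable up to the factor `2 * z.im`.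
The constant does not involve `R`, so it survives the limit `R → ∞`. -/
theorem poisson_far_le {δ R : ℝ} (hδ : 0 < δ) (hR : 1 ≤ R) {z : ℂ} (hz : ‖z‖ ^ 2 < 2 * R * z.im)
    (hzδ : ‖z‖ ≤ δ / 4) {φ : ℝ} (h1 : δ / R ≤ |φ|) (h2 : |φ| ≤ π) :
    (2 * R * z.im - ‖z‖ ^ 2) / ‖horocycle R φ - z‖ ^ 2 ≤
      2 * (2 * (1 + 2 / δ)) ^ 2 * z.im *
        ((2 * R * Complex.I.im - ‖Complex.I‖ ^ 2) / ‖horocycle R φ - Complex.I‖ ^ 2) := by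
  have hR0 : 0 < R := by linarith
  have hI : ‖Complex.I‖ ^ 2 < 2 * R * Complex.I.im := by simp; linarith
  have hz0 : 0 < z.im := by
    by_contra hcon
    nlinarith [sq_nonneg ‖z‖]
  set ζ := horocycle R φ with hζ
  have hn : δ / 2 ≤ ‖ζ‖ := by
    refine le_trans ?_ (le_norm_horocycle h2)
    rw [div_le_iff₀ hR0] at h1
    linarith
  have e1 : ‖ζ‖ / 2 ≤ ‖ζ - z‖ := by
    have := norm_sub_norm_le ζ z
    linarith
  have e2 : ‖ζ - Complex.I‖ ≤ (1 + 2 / δ) * ‖ζ‖ := by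
    have := norm_sub_le ζ Complex.I
    rw [Complex.norm_I] at this
    have h4 : 1 ≤ 2 / δ * ‖ζ‖ := by
      rw [div_mul_eq_mul_div, le_div_iff₀ hδ]
      linarith
    linarith
  have hL : 0 < 2 * (1 + 2 / δ) := by positivity
  have e3 : ‖ζ - Complex.I‖ ≤ 2 * (1 + 2 / δ) * ‖ζ - z‖ := by
    refine e2.trans ?_
    have : 0 < 1 + 2 / δ := by positivity
    nlinarith
  have p1 : 0 < ‖ζ - z‖ := norm_pos_iff.2 (horocycle_ne hR0 hz φ)
  have p2 : 0 < ‖ζ - Complex.I‖ := norm_pos_iff.2 (horocycle_ne hR0 hI φ)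
  have e4 : ‖ζ - Complex.I‖ ^ 2 ≤ (2 * (1 + 2 / δ)) ^ 2 * ‖ζ - z‖ ^ 2 := by
    rw [← mul_pow]
    gcongr
  set L := 2 * (1 + 2 / δ)
  rw [Complex.norm_I, Complex.I_im, ← mul_div_assoc, div_le_div_iff₀ (by positivity) (by positivity)]
  -- Here `R ≥ 1` enters, through `2R ≤ 2(2R - 1)`.
  have e5 : 2 * R * z.im - ‖z‖ ^ 2 ≤ 2 * z.im * (2 * R * 1 - 1 ^ 2) := by
    nlinarith [sq_nonneg ‖z‖]
  calc _ ≤ 2 * z.im * (2 * R * 1 - 1 ^ 2) * ‖ζ - Complex.I‖ ^ 2 := by gcongr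
    _ ≤ 2 * z.im * (2 * R * 1 - 1 ^ 2) * (L ^ 2 * ‖ζ - z‖ ^ 2) := by
        have : 0 ≤ 2 * R * 1 - 1 ^ 2 := by linarith
        gcongr
    _ = _ := by ring

/-- The far arc is absorbed into the Poisson integral at `i`, that is into `(F Complex.I).im`. The
near arc is rescaled by `s = R φ`, so that its domain no longer depends on `R`. -/
theorem im_le_integral_horocycle (hε : 0 < ε) (hF : DifferentiableOn ℂ F {w | -ε < w.im})
    (hpos : ∀ w : ℂ, -ε < w.im → 0 ≤ (F w).im) {δ R : ℝ} (hδ : 0 < δ) (hR : 1 ≤ R)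
    (hRδ : δ / R ≤ π) {z : ℂ} (hz : ‖z‖ ^ 2 < 2 * R * z.im) (hzδ : ‖z‖ ≤ δ / 4) :
    (F z).im ≤ 2 * (2 * (1 + 2 / δ)) ^ 2 * z.im * (F Complex.I).im +
      (2 * π)⁻¹ * ∫ s in -δ..δ, R⁻¹ * ((2 * R * z.im - ‖z‖ ^ 2) / ‖horocycle R (s / R) - z‖ ^ 2 *
        (F (horocycle R (s / R))).im) := by
  have hR0 : 0 < R := by linarith
  have hI : ‖Complex.I‖ ^ 2 < 2 * R * Complex.I.im := by simp; linarith
  set K := 2 * (2 * (1 + 2 / δ)) ^ 2 * z.im with hK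
  have hz0 : 0 < z.im := by
    by_contra hcon
    nlinarith [sq_nonneg ‖z‖]
  have hK0 : 0 < K := by positivity
  let P : ℂ → ℝ → ℝ := fun w φ => (2 * R * w.im - ‖w‖ ^ 2) / ‖horocycle R φ - w‖ ^ 2 *
    (F (horocycle R φ)).im
  have hu : ∀ φ, 0 ≤ (F (horocycle R φ)).im := fun φ =>
    hpos _ (by linarith [horocycle_im_nonneg hR0.le φ])
  have hPc : ∀ w : ℂ, ‖w‖ ^ 2 < 2 * R * w.im → Continuous (P w) := fun w hw => by
    refine Continuous.mul ?_ (Complex.continuous_im.comp (continuous_comp_horocycle hε hF hR0))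
    refine continuous_const.div (((continuous_horocycle R).sub continuous_const).norm.pow 2) ?_
    exact fun φ => pow_ne_zero _ (norm_ne_zero_iff.2 (horocycle_ne hR0 hw φ))
  have hP0 : ∀ w : ℂ, ‖w‖ ^ 2 < 2 * R * w.im → ∀ φ, 0 ≤ P w φ := fun w hw φ =>
    mul_nonneg (div_nonneg (by linarith) (by positivity)) (hu φ)
  have hfar : ∀ φ, δ / R ≤ |φ| → |φ| ≤ π → P z φ ≤ K * P Complex.I φ := fun φ h1 h2 => by
    have := mul_le_mul_of_nonneg_right (poisson_far_le hδ hR hz hzδ h1 h2) (hu φ)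
    simpa only [P, hK, mul_assoc] using this
  have i1 : ∀ a b, IntervalIntegrable (P z) volume a b := fun a b => (hPc z hz).intervalIntegrable a b
  have i2 : ∀ a b, IntervalIntegrable (fun φ => K * P Complex.I φ) volume a b := fun a b =>
    ((hPc _ hI).const_mul K).intervalIntegrable a b
  set a := δ / R with ha
  have ha0 : 0 < a := by positivity
  have key : ∫ φ in -π..π, P z φ ≤ (K * ∫ φ in -π..π, P Complex.I φ) + ∫ φ in -a..a, P z φ := by
    rw [← intervalIntegral.integral_const_mul,
      ← intervalIntegral.integral_add_adjacent_intervals (i1 (-π) (-a)) (i1 (-a) π),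
      ← intervalIntegral.integral_add_adjacent_intervals (i1 (-a) a) (i1 a π),
      ← intervalIntegral.integral_add_adjacent_intervals (i2 (-π) (-a)) (i2 (-a) π),
      ← intervalIntegral.integral_add_adjacent_intervals (i2 (-a) a) (i2 a π)]
    have j1 : ∫ φ in -π..-a, P z φ ≤ ∫ φ in -π..-a, K * P Complex.I φ := by
      refine intervalIntegral.integral_mono_on (by linarith) (i1 _ _) (i2 _ _) fun φ hφ => ?_
      have : |φ| = -φ := abs_of_neg (by linarith [hφ.2])
      exact hfar φ (by linarith [hφ.2]) (by linarith [hφ.1])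
    have j2 : ∫ φ in a..π, P z φ ≤ ∫ φ in a..π, K * P Complex.I φ := by
      refine intervalIntegral.integral_mono_on hRδ (i1 _ _) (i2 _ _) fun φ hφ => ?_
      have : |φ| = φ := abs_of_pos (by linarith [hφ.1])
      exact hfar φ (by linarith [hφ.1]) (by linarith [hφ.2])
    -- Positivity of `F.im` permits adding the missing near arc to complete the integral at `i`.
    have j3 : 0 ≤ ∫ φ in -a..a, K * P Complex.I φ :=
      intervalIntegral.integral_nonneg (by linarith) fun φ _ => mul_nonneg hK0.le (hP0 _ hI φ)
    linarith
  have hs : ∫ s in -δ..δ, R⁻¹ * P z (s / R) = ∫ φ in -a..a, P z φ := by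
    rw [intervalIntegral.integral_const_mul, intervalIntegral.integral_comp_div _ hR0.ne',
      smul_eq_mul, ← mul_assoc, inv_mul_cancel₀ hR0.ne', one_mul, neg_div]
  have hs' : ∫ s in -δ..δ, R⁻¹ * ((2 * R * z.im - ‖z‖ ^ 2) / ‖horocycle R (s / R) - z‖ ^ 2 *
        (F (horocycle R (s / R))).im) = ∫ φ in -a..a, P z φ := hs
  rw [hs', im_eq_integral_horocycle hε hF hR0 hz, im_eq_integral_horocycle hε hF hR0 hI]
  have := mul_le_mul_of_nonneg_left key (by positivity : (0:ℝ) ≤ (2 * π)⁻¹)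
  calc _ ≤ _ := this
    _ = _ := by simp only [P]; ring

end

/-! ### Flattening the circle to the real line as the radius grows -/

theorem tendsto_horocycle (s : ℝ) :
    Tendsto (fun R : ℝ => horocycle R (s / R)) atTop (𝓝 (s : ℂ)) := by
  have h0 : Tendsto (fun R : ℝ => s / R) atTop (𝓝 0) := tendsto_const_nhds.div_atTop tendsto_id
  have hre : Tendsto (fun R : ℝ => R * sin (s / R)) atTop (𝓝 s) := by
    have h1 : Tendsto (fun R : ℝ => s * sinc (s / R)) atTop (𝓝 (s * sinc 0)) :=
      ((continuous_sinc.tendsto 0).comp h0).const_mul s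
    rw [sinc_zero, mul_one] at h1
    refine h1.congr' ?_
    filter_upwards [eventually_gt_atTop 0] with R hR
    by_cases hs : s = 0
    · simp [hs]
    · rw [sinc_of_ne_zero (div_ne_zero hs hR.ne')]
      field_simp
  have him : Tendsto (fun R : ℝ => R * (1 - cos (s / R))) atTop (𝓝 0) := by
    have h1 : Tendsto (fun R : ℝ => s ^ 2 / 2 / R) atTop (𝓝 0) :=
      tendsto_const_nhds.div_atTop tendsto_id
    refine squeeze_zero' ?_ ?_ h1
    · filter_upwards [eventually_gt_atTop 0] with R hR
      exact horocycle_im_nonneg hR.le _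
    · filter_upwards [eventually_gt_atTop 0] with R hR
      have := one_sub_sq_div_two_le_cos (x := s / R)
      calc R * (1 - cos (s / R)) ≤ R * ((s / R) ^ 2 / 2) := by gcongr; linarith
        _ = s ^ 2 / 2 / R := by field_simp
  have := (Complex.continuous_ofReal.tendsto _).comp hre |>.add
    (((Complex.continuous_ofReal.tendsto _).comp him).mul_const Complex.I)
  simp only [Complex.ofReal_zero, zero_mul, add_zero] at this
  refine this.congr fun R => ?_
  exact (Complex.re_add_im (horocycle R (s / R)))

theorem horocycle_im_le {R : ℝ} (hR : 0 < R) (s : ℝ) :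
    (horocycle R (s / R)).im ≤ s ^ 2 / 2 / R := by
  have := one_sub_sq_div_two_le_cos (x := s / R)
  calc R * (1 - cos (s / R)) ≤ R * ((s / R) ^ 2 / 2) := by gcongr; linarith
    _ = s ^ 2 / 2 / R := by field_simp

theorem abs_horocycle_re_le {R : ℝ} (hR : 0 < R) (s : ℝ) : |(horocycle R (s / R)).re| ≤ |s| := by
  calc |R * sin (s / R)| = R * |sin (s / R)| := by rw [abs_mul, abs_of_pos hR]
    _ ≤ R * |s / R| := mul_le_mul_of_nonneg_left abs_sin_le_abs hR.le
    _ = |s| := by rw [abs_div, abs_of_pos hR]; field_simp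

/-- A function with nonnegative imaginary part on a neighborhood of the closed upper half plane is
bounded near `0` by a multiple of the height plus a truncated Poisson integral. -/
theorem im_le_poisson {F : ℂ → ℂ} {ε : ℝ} (hε : 0 < ε)
    (hF : DifferentiableOn ℂ F {w | -ε < w.im}) (hpos : ∀ w : ℂ, -ε < w.im → 0 ≤ (F w).im)
    {δ : ℝ} (hδ : 0 < δ) {z : ℂ} (hz : 0 < z.im) (hzδ : ‖z‖ ≤ δ / 4) :
    (F z).im ≤ 2 * (2 * (1 + 2 / δ)) ^ 2 * z.im * (F Complex.I).im +
      π⁻¹ * ∫ s in -δ..δ, z.im * ((z.re - s) ^ 2 + z.im ^ 2)⁻¹ * (F s).im := by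
  set c := 2 * (2 * (1 + 2 / δ)) ^ 2 * z.im * (F Complex.I).im
  have hev : ∀ᶠ R : ℝ in atTop, 1 ≤ R ∧ δ / R ≤ π ∧ ‖z‖ ^ 2 < 2 * R * z.im ∧
      δ ^ 2 / 2 / R ≤ z.im / 2 := by
    have h1 : Tendsto (fun R : ℝ => δ / R) atTop (𝓝 0) := tendsto_const_nhds.div_atTop tendsto_id
    have h2 : Tendsto (fun R : ℝ => δ ^ 2 / 2 / R) atTop (𝓝 0) :=
      tendsto_const_nhds.div_atTop tendsto_id
    filter_upwards [eventually_ge_atTop 1, h1.eventually_le_const pi_pos,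
      eventually_gt_atTop (‖z‖ ^ 2 / (2 * z.im)),
      h2.eventually_le_const (half_pos hz)] with R a1 a2 a3 a4
    refine ⟨a1, a2, ?_, a4⟩
    rw [div_lt_iff₀ (by linarith)] at a3
    linarith
  have hlim : Tendsto (fun R : ℝ => ∫ s in -δ..δ,
      R⁻¹ * ((2 * R * z.im - ‖z‖ ^ 2) / ‖horocycle R (s / R) - z‖ ^ 2 *
        (F (horocycle R (s / R))).im)) atTop
      (𝓝 (∫ s in -δ..δ, 2 * z.im / ‖(s : ℂ) - z‖ ^ 2 * (F s).im)) := by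
    -- For large `R` the near arc stays in this rectangle. There `F` is bounded and points are at
    -- distance at least `z.im / 2` from `z`, which gives the dominating constant below.
    have hK : IsCompact (Icc (-δ) δ ×ℂ Icc 0 (z.im / 2)) := isCompact_Icc.reProdIm isCompact_Icc
    obtain ⟨M, hM⟩ := hK.exists_bound_of_continuousOn (hF.continuousOn.mono fun w hw => by
      have : 0 ≤ w.im := hw.2.1
      show -ε < w.im
      linarith)
    have hM0 : 0 ≤ M := (norm_nonneg _).trans (hM 0 (by
      simp only [Complex.mem_reProdIm, Complex.zero_re, Complex.zero_im, mem_Icc]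
      refine ⟨⟨by linarith, hδ.le⟩, le_rfl, by linarith⟩))
    refine intervalIntegral.tendsto_integral_filter_of_dominated_convergence
      (fun _ => 2 * z.im / (z.im / 2) ^ 2 * M) ?_ ?_ (by simp) ?_
    · filter_upwards [hev] with R ⟨h1, _, h3, _⟩
      have hR0 : 0 < R := by linarith
      have hh : Continuous fun s => horocycle R (s / R) :=
        (continuous_horocycle R).comp (by fun_prop)
      refine (continuous_const.mul (Continuous.mul (continuous_const.div
        ((hh.sub continuous_const).norm.pow 2) fun s => ?_)
        (Complex.continuous_im.comp ?_))).aestronglyMeasurable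
      · exact pow_ne_zero _ (norm_ne_zero_iff.2 (horocycle_ne hR0 h3 _))
      · exact (continuous_comp_horocycle hε hF hR0).comp (by fun_prop : Continuous fun s => s / R)
    · filter_upwards [hev] with R ⟨h1, _, h3, h4⟩
      refine Eventually.of_forall fun s hs => ?_
      have hR0 : 0 < R := by linarith
      rw [uIoc_of_le (by linarith)] at hs
      have hsδ : |s| ≤ δ := abs_le.2 ⟨hs.1.le, hs.2⟩
      set ζ := horocycle R (s / R)
      have hr := abs_le.1 ((abs_horocycle_re_le hR0 s).trans hsδ)
      have hi0 : 0 ≤ ζ.im := horocycle_im_nonneg hR0.le _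
      have hi : ζ.im ≤ z.im / 2 := by
        refine (horocycle_im_le hR0 s).trans (le_trans ?_ h4)
        have := sq_le_sq' (by linarith [hs.1]) hs.2
        gcongr
      have hFζ : |(F ζ).im| ≤ M := (Complex.abs_im_le_norm _).trans (hM ζ ⟨hr, hi0, hi⟩)
      have hd : z.im / 2 ≤ ‖ζ - z‖ := by
        have := Complex.abs_im_le_norm (ζ - z)
        rw [Complex.sub_im] at this
        have := (abs_le.1 this).1
        linarith
      rw [← mul_assoc, norm_mul, Real.norm_eq_abs, Real.norm_eq_abs]
      have hcoef : 0 ≤ R⁻¹ * ((2 * R * z.im - ‖z‖ ^ 2) / ‖ζ - z‖ ^ 2) := by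
        have : 0 ≤ 2 * R * z.im - ‖z‖ ^ 2 := by linarith
        positivity
      rw [abs_of_nonneg hcoef]
      have hcoef2 : R⁻¹ * ((2 * R * z.im - ‖z‖ ^ 2) / ‖ζ - z‖ ^ 2) ≤ 2 * z.im / (z.im / 2) ^ 2 := by
        rw [← mul_div_assoc]
        have : R⁻¹ * (2 * R * z.im - ‖z‖ ^ 2) ≤ 2 * z.im := by
          rw [inv_mul_le_iff₀ hR0]
          nlinarith [sq_nonneg ‖z‖]
        gcongr
      gcongr
    · refine Eventually.of_forall fun s _ => ?_
      have hsz : ‖(s : ℂ) - z‖ ^ 2 ≠ 0 := by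
        refine pow_ne_zero _ (norm_ne_zero_iff.2 fun h => ?_)
        have := congrArg Complex.im h
        simp at this
        linarith
      have h1 := tendsto_horocycle s
      have hFc : ContinuousAt F s := by
        refine (hF.differentiableAt (IsOpen.mem_nhds ?_ ?_)).continuousAt
        · exact isOpen_lt continuous_const Complex.continuous_im
        · simpa using hε
      have h2 : Tendsto (fun R : ℝ => (F (horocycle R (s / R))).im) atTop (𝓝 (F s).im) :=
        (Complex.continuous_im.tendsto _).comp (hFc.tendsto.comp h1)
      have h3 : Tendsto (fun R : ℝ => 2 * z.im - ‖z‖ ^ 2 / R) atTop (𝓝 (2 * z.im - 0)) :=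
        tendsto_const_nhds.sub (tendsto_const_nhds.div_atTop tendsto_id)
      rw [sub_zero] at h3
      refine ((h3.div ((h1.sub_const z).norm.pow 2) hsz).mul h2).congr' ?_
      filter_upwards [eventually_gt_atTop 0] with R hR
      simp only [Pi.div_apply]
      rw [← mul_assoc, ← mul_div_assoc]
      congr 2
      field_simp
  have hlim2 := (hlim.const_mul (2 * π)⁻¹).const_add c
  have hle := ge_of_tendsto hlim2 (b := (F z).im) (by
    filter_upwards [hev] with R ⟨h1, h2, h3, _⟩
    exact im_le_integral_horocycle hε hF hpos hδ h1 h2 h3 hzδ)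
  refine hle.trans (le_of_eq ?_)
  congr 1
  rw [← intervalIntegral.integral_const_mul, ← intervalIntegral.integral_const_mul]
  congr 1
  funext s
  have : ‖(s : ℂ) - z‖ ^ 2 = (z.re - s) ^ 2 + z.im ^ 2 := by
    rw [Complex.sq_norm, Complex.normSq_apply]
    simp
    ring
  rw [this, mul_inv]
  ring

/-! ### The localized Nevanlinna bound for Pick functions -/

theorem IsPick.im_nonneg {f : ℂ → ℂ} (hf : IsPick f) {z : ℂ} (hz : 0 < z.im) : 0 ≤ (f z).im := by
  have := hf.mapsTo (mem_halfPlane.2 hz)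
  rwa [closure_halfPlane] at this

theorem IsPick.continuousAt {f : ℂ → ℂ} (hf : IsPick f) {z : ℂ} (hz : 0 < z.im) :
    ContinuousAt f z := (hf.analytic z hz).continuousAt

/-- The upper half of the Nevanlinna representation, localized at a boundary point. -/
theorem IsPick.exists_im_le {f : ℂ → ℂ} (hf : IsPick f) {μ : Measure ℝ}
    (hμ : IsNevanlinnaMeasure f μ) (τ : ℝ) {δ : ℝ} (hδ : 0 < δ) :
    ∃ K : ℝ, 0 ≤ K ∧ ∀ z : ℂ, 0 < z.im → ‖z - τ‖ ≤ δ / 4 →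
      (f z).im / z.im ≤
        K + ∫ t in Icc (τ - 2 * δ) (τ + 2 * δ), ((z.re - t) ^ 2 + z.im ^ 2)⁻¹ ∂μ := by
  have := hμ.locallyFinite
  have hI : 0 < ((τ : ℂ) + Complex.I).im := by simp
  have h0 : 0 ≤ (f (τ + Complex.I)).im := hf.im_nonneg hI
  refine ⟨2 * (2 * (1 + 2 / δ)) ^ 2 * (f (τ + Complex.I)).im, by positivity, fun z hz hzδ => ?_⟩
  -- The cutoff turns the truncated Poisson kernel into an admissible test function for the weak
  -- limit; the price is the interval of radius `2 * δ` in the conclusion.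
  let χ : ContDiffBump τ := ⟨δ, 2 * δ, hδ, by linarith⟩
  let g : ℝ → ℝ := fun x => χ x * (z.im * ((z.re - x) ^ 2 + z.im ^ 2)⁻¹)
  have hden : ∀ x : ℝ, 0 < (z.re - x) ^ 2 + z.im ^ 2 := fun x => by positivity
  have hkc : Continuous fun x : ℝ => z.im * ((z.re - x) ^ 2 + z.im ^ 2)⁻¹ :=
    continuous_const.mul (Continuous.inv₀ (by fun_prop) fun x => (hden x).ne')
  have hg : Continuous g := χ.continuous.mul hkc
  have hgs : HasCompactSupport g := χ.hasCompactSupport.mul_right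
  have hg0 : ∀ x, 0 ≤ g x := fun x =>
    mul_nonneg χ.nonneg (mul_nonneg hz.le (inv_nonneg.2 (hden x).le))
  have hlim := hμ.tendsto g hg hgs
  have hshift : ∀ w : ℂ, Tendsto (fun y : ℝ => w + y * Complex.I) (𝓝[>] 0) (𝓝 w) := fun w => by
    have : Tendsto (fun y : ℝ => w + y * Complex.I) (𝓝 0) (𝓝 (w + (0 : ℝ) * Complex.I)) :=
      Continuous.tendsto (by fun_prop) 0
    simp only [Complex.ofReal_zero, zero_mul, add_zero] at this
    exact this.mono_left nhdsWithin_le_nhds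
  have hft : ∀ w : ℂ, 0 < w.im →
      Tendsto (fun y : ℝ => (f (w + y * Complex.I)).im) (𝓝[>] 0) (𝓝 (f w).im) := fun w hw =>
    (Complex.continuous_im.tendsto _).comp ((hf.continuousAt hw).tendsto.comp (hshift w))
  have hle : (f z).im ≤ 2 * (2 * (1 + 2 / δ)) ^ 2 * z.im * (f (τ + Complex.I)).im +
      π⁻¹ * ∫ x, g x ∂μ := by
    refine le_of_tendsto_of_tendsto (hft z hz)
      (((hft _ hI).const_mul (2 * (2 * (1 + 2 / δ)) ^ 2 * z.im)).add (hlim.const_mul π⁻¹)) ?_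
    filter_upwards [self_mem_nhdsWithin] with ε hε
    have hε : 0 < ε := hε
    have hup : ∀ w : ℂ, -ε < w.im → 0 < (w + τ + ε * Complex.I).im := fun w hw => by
      simp
      linarith
    -- The upward shift by `ε` gives a function analytic across the real line; the translation by
    -- `τ` moves the boundary point to `0`.
    have key := im_le_poisson (F := fun w => f (w + τ + ε * Complex.I)) hε
      (fun w hw => (((hf.analytic _ (hup w hw)).differentiableAt.comp w
        (by fun_prop : DifferentiableAt ℂ (fun w : ℂ => w + τ + ε * Complex.I) w))
          ).differentiableWithinAt)
      (fun w hw => hf.im_nonneg (hup w hw)) hδ (z := z - τ) (by simpa using hz) hzδ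
    simp only [sub_add_cancel, Complex.sub_im, Complex.ofReal_im, sub_zero, Complex.sub_re,
      Complex.ofReal_re] at key
    rw [add_comm Complex.I (τ : ℂ)] at key
    refine key.trans (add_le_add le_rfl (mul_le_mul_of_nonneg_left ?_ (inv_nonneg.2 pi_pos.le)))
    have hfc : Continuous fun x : ℝ => (f (x + ε * Complex.I)).im := by
      refine Complex.continuous_im.comp (continuous_iff_continuousAt.2 fun x => ?_)
      have hx : 0 < ((x : ℂ) + ε * Complex.I).im := by simpa using hε
      exact ContinuousAt.comp (f := fun x : ℝ => (x : ℂ) + ε * Complex.I) (hf.continuousAt hx)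
        (by fun_prop)
    have hf0 : ∀ x : ℝ, 0 ≤ (f (x + ε * Complex.I)).im := fun x =>
      hf.im_nonneg (by simpa using hε)
    have hsub : ∫ s in -δ..δ, z.im * ((z.re - τ - s) ^ 2 + z.im ^ 2)⁻¹ *
        (f (s + τ + ε * Complex.I)).im = ∫ x in (-δ + τ)..(δ + τ),
          z.im * ((z.re - x) ^ 2 + z.im ^ 2)⁻¹ * (f (x + ε * Complex.I)).im := by
      rw [← intervalIntegral.integral_comp_add_right (fun x : ℝ =>
        z.im * ((z.re - x) ^ 2 + z.im ^ 2)⁻¹ * (f (x + ε * Complex.I)).im)]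
      congr 1
      funext s
      rw [sub_sub, add_comm τ s]
      push_cast
      rfl
    rw [hsub, intervalIntegral.integral_of_le (by linarith)]
    have hcongr : ∫ x in Ioc (-δ + τ) (δ + τ),
        z.im * ((z.re - x) ^ 2 + z.im ^ 2)⁻¹ * (f (x + ε * Complex.I)).im =
        ∫ x in Ioc (-δ + τ) (δ + τ), g x * (f (x + ε * Complex.I)).im := by
      refine setIntegral_congr_fun measurableSet_Ioc fun x hx => ?_
      have hx1 : χ x = 1 := χ.one_of_mem_closedBall (by
        rw [Metric.mem_closedBall, Real.dist_eq, abs_le]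
        exact ⟨by linarith [hx.1], by linarith [hx.2]⟩)
      simp only [g, hx1, one_mul]
    rw [hcongr]
    refine setIntegral_le_integral ?_ (Eventually.of_forall fun x => mul_nonneg (hg0 x) (hf0 x))
    exact (hg.mul hfc).integrable_of_hasCompactSupport hgs.mul_right
  have hint : ∫ x, g x ∂μ ≤
      z.im * ∫ t in Icc (τ - 2 * δ) (τ + 2 * δ), ((z.re - t) ^ 2 + z.im ^ 2)⁻¹ ∂μ := by
    have hsupp : ∀ x ∉ Icc (τ - 2 * δ) (τ + 2 * δ), g x = 0 := fun x hx => by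
      have : χ x = 0 := χ.zero_of_le_dist (by
        by_contra hcon
        rw [not_le, Real.dist_eq, abs_lt] at hcon
        have h1 : -(2 * δ) < x - τ := hcon.1
        have h2 : x - τ < 2 * δ := hcon.2
        exact hx ⟨by linarith, by linarith⟩)
      simp only [g, this, zero_mul]
    rw [← setIntegral_eq_integral_of_forall_compl_eq_zero hsupp, ← integral_const_mul]
    refine setIntegral_mono_on (hg.continuousOn.integrableOn_compact isCompact_Icc)
      (hkc.continuousOn.integrableOn_compact isCompact_Icc) measurableSet_Icc fun x _ => ?_
    exact mul_le_of_le_one_left (mul_nonneg hz.le (inv_nonneg.2 (hden x).le)) χ.le_one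
  have hpi : π⁻¹ ≤ 1 := inv_le_one_of_one_le₀ (by linarith [pi_gt_three])
  have hint0 : 0 ≤ ∫ x, g x ∂μ := integral_nonneg hg0
  rw [div_le_iff₀ hz]
  calc (f z).im ≤ _ := hle
    _ ≤ 2 * (2 * (1 + 2 / δ)) ^ 2 * z.im * (f (τ + Complex.I)).im + 1 * ∫ x, g x ∂μ := by gcongr
    _ ≤ 2 * (2 * (1 + 2 / δ)) ^ 2 * z.im * (f (τ + Complex.I)).im +
        z.im * ∫ t in Icc (τ - 2 * δ) (τ + 2 * δ), ((z.re - t) ^ 2 + z.im ^ 2)⁻¹ ∂μ := by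
      rw [one_mul]
      gcongr
    _ = _ := by ring

/-! ### Kernel estimates and comparison with the rate -/

theorem inv_sq_add_sq_eq {y : ℝ} (hy : 0 < y) (a x : ℝ) :
    ((x - a) ^ 2 + y ^ 2)⁻¹ = (y ^ 2)⁻¹ * (1 + ((x - a) / y) ^ 2)⁻¹ := by
  rw [← mul_inv]
  congr 1
  field_simp
  ring

theorem integrable_inv_sq_add_sq {y : ℝ} (hy : 0 < y) (a : ℝ) :
    Integrable fun x : ℝ => ((x - a) ^ 2 + y ^ 2)⁻¹ := by
  simp only [inv_sq_add_sq_eq hy]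
  exact ((integrable_inv_one_add_sq.comp_div hy.ne').comp_sub_right a).const_mul _

theorem integral_inv_sq_add_sq {y : ℝ} (hy : 0 < y) (a : ℝ) :
    ∫ x : ℝ, ((x - a) ^ 2 + y ^ 2)⁻¹ = π / y := by
  simp only [inv_sq_add_sq_eq hy]
  rw [integral_const_mul, integral_sub_right_eq_self (fun x : ℝ => (1 + (x / y) ^ 2)⁻¹) a,
    Measure.integral_comp_div (fun x : ℝ => (1 + x ^ 2)⁻¹) y, integral_univ_inv_one_add_sq,
    abs_of_pos hy, smul_eq_mul]
  field_simp

/-- No sign is required of `w`: for `w ≤ 0` the right side is `∞`. This covers the points where `γ`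
vanishes. -/
theorem ofReal_inv_le {v w c : ℝ} (hv : 0 < v) (hc : 0 < c) (h : w ≤ c * v) :
    ENNReal.ofReal v⁻¹ ≤ ENNReal.ofReal c * (ENNReal.ofReal w)⁻¹ := by
  calc ENNReal.ofReal v⁻¹ = ENNReal.ofReal (c * (c * v)⁻¹) := by
        rw [mul_inv, ← mul_assoc, mul_inv_cancel₀ hc.ne', one_mul]
    _ = ENNReal.ofReal c * (ENNReal.ofReal (c * v))⁻¹ := by
        rw [ENNReal.ofReal_mul hc.le, ENNReal.ofReal_inv_of_pos (by positivity)]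
    _ ≤ _ := by gcongr

theorem IsBigO.exists_le_mul_sq {γ : ℝ → ℝ} (h : γ =O[𝓝[>] (0 : ℝ)] fun t : ℝ => t ^ 2) :
    ∃ k > 0, ∃ r > 0, ∀ s, 0 < s → s ≤ r → γ s ≤ k * s ^ 2 := by
  obtain ⟨k, hk, hb⟩ := h.exists_pos
  obtain ⟨r, hr, hr'⟩ := mem_nhdsGT_iff_exists_Ioc_subset.1 hb.bound
  refine ⟨k, hk, r, hr, fun s hs hsr => ?_⟩
  have := hr' ⟨hs, hsr⟩
  simp only [mem_ofPred_eq, Real.norm_eq_abs, abs_pow, sq_abs] at this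
  exact (le_abs_self _).trans this

/-! ### Bounded Julia quotients for regular functions -/

section

variable {γ : ℝ → ℝ} {τ : ℝ} {f : ℂ → ℂ}

/-- Quantitative form of regularity: the Julia quotient is controlled near `τ` by an integral of the
Poisson kernel against a measure for which `1 / γ (c |t - τ|)` is integrable. -/
theorem IsRegularAt.exists_julia_le (hγ : γ =O[𝓝[>] (0 : ℝ)] fun t : ℝ => t ^ 2)
    (hf : IsPick f) (hreg : IsRegularAt γ τ f) :
    ∃ μ : Measure ℝ, SFinite μ ∧ ∃ c > 0, ∃ k > 0, ∃ r > 0, ∃ K : ℝ, 0 ≤ K ∧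
      ∫⁻ t in Icc (τ - r) (τ + r), (ENNReal.ofReal (γ (c * |t - τ|)))⁻¹ ∂μ < ∞ ∧
      (∀ s, 0 < s → s ≤ r → γ (c * s) ≤ k * s ^ 2) ∧
      ∀ z : ℂ, 0 < z.im → ‖z - τ‖ ≤ r / 8 → ENNReal.ofReal ((f z).im / z.im) ≤ ENNReal.ofReal K +
        ∫⁻ t in Icc (τ - r) (τ + r), ENNReal.ofReal ((z.re - t) ^ 2 + z.im ^ 2)⁻¹ ∂μ := by
  obtain ⟨μ, hμ, c, hc, U, hU, hint⟩ := hreg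
  have := hμ.locallyFinite
  obtain ⟨k, hk, ρ, hρ, hkρ⟩ := IsBigO.exists_le_mul_sq hγ
  obtain ⟨η, hη, hηU⟩ := Metric.nhds_basis_closedBall.mem_iff.1 hU
  -- `η` keeps the interval inside the neighborhood of integrability, and `ρ / c` keeps `c * s` in
  -- the range of the quadratic bound. The kernel bound is used with `δ = r / 2`.
  set r := min η (ρ / c) with hr
  have hr0 : 0 < r := lt_min hη (by positivity)
  obtain ⟨K, hK, hb⟩ := hf.exists_im_le hμ τ (half_pos hr0)
  rw [mul_div_cancel₀ r two_ne_zero] at hb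
  refine ⟨μ, inferInstance, c, hc, k * c ^ 2, by positivity, r, hr0, K, hK, ?_, ?_, ?_⟩
  · refine (lintegral_mono_set ?_).trans_lt hint
    rw [← Real.closedBall_eq_Icc]
    exact (Metric.closedBall_subset_closedBall (min_le_left _ _)).trans hηU
  · intro s hs hsr
    refine (hkρ _ (by positivity) ?_).trans (le_of_eq (by ring))
    have := hsr.trans (min_le_right η (ρ / c))
    rw [le_div_iff₀ hc] at this
    linarith
  · intro z hz hzr
    have h1 := hb z hz (by linarith)
    have hden : ∀ t : ℝ, 0 < (z.re - t) ^ 2 + z.im ^ 2 := fun t => by positivity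
    have hcont : Continuous fun t : ℝ => ((z.re - t) ^ 2 + z.im ^ 2)⁻¹ :=
      Continuous.inv₀ (by fun_prop) fun t => (hden t).ne'
    rw [← ofReal_integral_eq_lintegral_ofReal
      (hcont.continuousOn.integrableOn_compact isCompact_Icc)
      (Eventually.of_forall fun t => (inv_nonneg.2 (hden t).le)), ← ENNReal.ofReal_add hK
      (integral_nonneg fun t => (inv_nonneg.2 (hden t).le))]
    exact ENNReal.ofReal_le_ofReal h1

theorem inv_sq_add_sq_le {x y t τ : ℝ} (h : 2 * |x - τ| < |t - τ|) :
    ((x - t) ^ 2 + y ^ 2)⁻¹ ≤ (|t - τ| ^ 2 / 4)⁻¹ := by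
  have h0 : 0 < |t - τ| := lt_of_le_of_lt (by positivity) h
  refine inv_anti₀ (by positivity) ?_
  have h1 : |t - τ| ≤ |x - τ| + |x - t| := by
    have := abs_sub_le t x τ
    rw [abs_sub_comm t x] at this
    linarith
  have h2 : |t - τ| / 2 ≤ |x - t| := by linarith
  have h3 : (|t - τ| / 2) ^ 2 ≤ |x - t| ^ 2 := by gcongr
  rw [sq_abs (x - t)] at h3
  nlinarith [sq_nonneg y]

theorem eventually_mem_and_norm_sub_le (τ : ℝ) {r : ℝ} (hr : 0 < r) (S : Set ℂ) :
    ∀ᶠ z in 𝓝[S] (τ : ℂ), z ∈ S ∧ ‖z - τ‖ ≤ r := by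
  filter_upwards [self_mem_nhdsWithin, nhdsWithin_le_nhds (Metric.closedBall_mem_nhds (τ : ℂ) hr)]
    with z h1 h2
  exact ⟨h1, by simpa [dist_eq_norm] using h2⟩

/-- The kernel is compared pointwise with `1 / γ(c|t - τ|)`, splitting at `|t - τ| = 2|x - τ|`. The
factor `2` in this split is the factor in `C = 2c`, which is therefore independent of `D`. -/
theorem IsRegularAt.exists_juliaQuotient_le (hγm : MonotoneOn γ (Ici 0)) (hγ : γ =O[𝓝[>] (0 : ℝ)] fun t : ℝ => t ^ 2)
    (hf : IsPick f) (hreg : IsRegularAt γ τ f) :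
    ∃ C : ℝ, 0 < C ∧ ∀ D : ℝ, 0 < D → ∃ M : ℝ,
      ∀ᶠ z in 𝓝[stolzRegion halfPlane (fun t => √(D * γ (C * t))) τ] (τ : ℂ),
        juliaQuotient halfPlane halfPlane f z ≤ M := by
  obtain ⟨μ, -, c, hc, k, hk, r, hr, K, hK, hA, hkr, hJ⟩ := hreg.exists_julia_le hγ hf
  refine ⟨2 * c, by positivity, fun D hD => ?_⟩
  set I := Icc (τ - r) (τ + r)
  set A := ∫⁻ t in I, (ENNReal.ofReal (γ (c * |t - τ|)))⁻¹ ∂μ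
  -- `4 * k` serves the far `t`, `D⁻¹` the near ones.
  set m := max (4 * k) D⁻¹
  have hm : 0 < m := lt_max_of_lt_left (by positivity)
  have hfin : ENNReal.ofReal K + ENNReal.ofReal m * A ≠ ∞ :=
    ENNReal.add_ne_top.2 ⟨ENNReal.ofReal_ne_top, ENNReal.mul_ne_top ENNReal.ofReal_ne_top hA.ne⟩
  refine ⟨(ENNReal.ofReal K + ENNReal.ofReal m * A).toReal, ?_⟩
  filter_upwards [eventually_mem_and_norm_sub_le τ (by positivity : 0 < r / 8) _] with z ⟨hz, hzr⟩
  obtain ⟨hy, s, hs, hsy, hxs⟩ := mem_stolzRegion_halfPlane.1 hz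
  rw [juliaQuotient_halfPlane hf hy]
  refine (ENNReal.ofReal_le_iff_le_toReal hfin).1 ((hJ z hy hzr).trans ?_)
  refine add_le_add le_rfl ?_
  rw [← lintegral_const_mul' _ _ ENNReal.ofReal_ne_top]
  refine setLIntegral_mono' measurableSet_Icc fun t ht => ?_
  have htr : |t - τ| ≤ r := abs_le.2 ⟨by linarith [ht.1], by linarith [ht.2]⟩
  rcases lt_or_ge (2 * |z.re - τ|) |t - τ| with h | h
  · have h0 : 0 < |t - τ| := lt_of_le_of_lt (by positivity) h
    refine (ENNReal.ofReal_le_ofReal (inv_sq_add_sq_le h)).trans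
      (ofReal_inv_le (by positivity) hm ?_)
    calc γ (c * |t - τ|) ≤ k * |t - τ| ^ 2 := hkr _ h0 htr
      _ = 4 * k * (|t - τ| ^ 2 / 4) := by ring
      _ ≤ m * (|t - τ| ^ 2 / 4) := by gcongr; exact le_max_left _ _
  · have h1 : ((z.re - t) ^ 2 + z.im ^ 2)⁻¹ ≤ (z.im ^ 2)⁻¹ :=
      inv_anti₀ (by positivity) (by nlinarith [sq_nonneg (z.re - t)])
    refine (ENNReal.ofReal_le_ofReal h1).trans (ofReal_inv_le (by positivity) hm ?_)
    have h2 : D * γ (2 * c * s) ≤ z.im ^ 2 := (Real.sqrt_le_left hy.le).1 hsy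
    have h3 : γ (c * |t - τ|) ≤ γ (2 * c * s) := by
      refine hγm (by simp only [mem_Ici]; positivity) (by simp only [mem_Ici]; positivity) ?_
      nlinarith
    calc γ (c * |t - τ|) ≤ D⁻¹ * (D * γ (2 * c * s)) := by
          rwa [inv_mul_cancel_left₀ hD.ne']
      _ ≤ D⁻¹ * z.im ^ 2 := by gcongr
      _ ≤ m * z.im ^ 2 := by gcongr; exact le_max_right _ _

/-- An open set misses its frontier, so the arc is empty and the average takes its default value.
Nonemptiness of the frontier matters because `Metric.infDist` to the empty set is `0`. -/
theorem amortizedJuliaQuotient_eq_zero {D Ω : Set ℂ} (hD : IsOpen D) (hDc : (frontier D).Nonempty)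
    {lam : ℝ → ℝ} {τ : ℂ} {d : ℝ} (hl : lam d = 0) :
    amortizedJuliaQuotient D Ω f lam τ d = 0 := by
  have : stolzArc D lam τ d = ∅ := by
    refine eq_empty_of_forall_notMem fun z hz => ?_
    have h1 := (isClosed_frontier.mem_iff_infDist_zero hDc).2 (hz.2.1.trans hl)
    rw [hD.frontier_eq] at h1
    exact h1.2 hz.1
  rw [amortizedJuliaQuotient, this, setAverage_eq]
  simp

theorem amortizedJuliaQuotient_congr {D Ω : Set ℂ} {lam lam' : ℝ → ℝ} {τ : ℂ} {d : ℝ}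
    (h : lam d = lam' d) :
    amortizedJuliaQuotient D Ω f lam τ d = amortizedJuliaQuotient D Ω f lam' τ d := by
  simp only [amortizedJuliaQuotient, stolzArc, h]

/-- After Tonelli, each `t` contributes the integral of its kernel over the segment. For `|t - τ| >
2d` this is at most `8d / |t - τ|²`; otherwise it is at most the full mass `π / l`. With `l = γ(2cd)
/ (2cd)` both are `O(d) / γ(c|t - τ|)`, and the length `2d` of the segment cancels the `d`. -/
theorem IsRegularAt.exists_amortizedJuliaQuotient_le (hγ0 : ∀ t : ℝ, 0 ≤ t → 0 ≤ γ t)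
    (hγm : MonotoneOn γ (Ici 0)) (hγ : γ =O[𝓝[>] (0 : ℝ)] fun t : ℝ => t ^ 2)
    (hf : IsPick f) (hreg : IsRegularAt γ τ f) :
    ∃ C : ℝ, 0 < C ∧ ∃ M : ℝ, ∀ᶠ d in 𝓝[>] (0 : ℝ),
      amortizedJuliaQuotient halfPlane halfPlane f (fun t => γ (C * t) / (C * t)) τ d ≤ M := by
  obtain ⟨μ, _, c, hc, k, hk, r, hr, K, hK, hA, hkr, hJ⟩ := hreg.exists_julia_le hγ hf
  refine ⟨2 * c, by positivity, ?_⟩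
  set I := Icc (τ - r) (τ + r)
  set A := ∫⁻ t in I, (ENNReal.ofReal (γ (c * |t - τ|)))⁻¹ ∂μ
  set m := max (8 * k) (π * (2 * c))
  have hm : 0 < m := lt_max_of_lt_left (by positivity)
  refine ⟨K + m * A.toReal, ?_⟩
  have hM0 : 0 ≤ K + m * A.toReal := by positivity
  have hsmall : Tendsto (fun d : ℝ => d + 2 * k * d / c) (𝓝[>] 0) (𝓝 0) := by
    have : Tendsto (fun d : ℝ => d + 2 * k * d / c) (𝓝 0) (𝓝 (0 + 2 * k * 0 / c)) :=
      Continuous.tendsto (by fun_prop) 0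
    simp only [mul_zero, zero_div, add_zero] at this
    exact this.mono_left nhdsWithin_le_nhds
  filter_upwards [self_mem_nhdsWithin, Ioc_mem_nhdsGT (half_pos hr),
    hsmall.eventually_le_const (by positivity : 0 < r / 8)] with d hd hdr hds
  have hd : 0 < d := hd
  set l := γ (2 * c * d) / (2 * c * d) with hl
  have hl0 : 0 ≤ l := div_nonneg (hγ0 _ (by positivity)) (by positivity)
  rcases hl0.eq_or_lt with h0 | hlpos
  · rw [amortizedJuliaQuotient_eq_zero (lam := fun t => γ (2 * c * t) / (2 * c * t)) (UpperHalfPlane.isOpen_upperHalfPlaneSet)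
      (by rw [frontier_halfPlane]; exact ⟨0, by simp⟩) h0.symm]
    exact hM0
  -- The quadratic bound at `2 * d` makes the height `O(d)`, so the whole arc lies in the disc where
  -- the kernel bound holds.
  have hlle : l ≤ 2 * k * d / c := by
    rw [hl, div_le_div_iff₀ (by positivity) hc]
    have := hkr (2 * d) (by linarith) (by linarith [hdr.2])
    rw [show c * (2 * d) = 2 * c * d by ring] at this
    nlinarith
  rw [amortizedJuliaQuotient_halfPlane hf hd hlpos, inv_mul_le_iff₀ (by positivity)]
  show ∫ x in Icc (τ - d) (τ + d), (f (x + l * Complex.I)).im / l ≤ _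
  set J : ℝ → ℝ := fun x => (f (x + l * Complex.I)).im / l with hJdef
  have him : ∀ x : ℝ, ((x : ℂ) + l * Complex.I).im = l := fun x => by simp
  have hre : ∀ x : ℝ, ((x : ℂ) + l * Complex.I).re = x := fun x => by simp
  have hJ0 : ∀ x, 0 ≤ J x := fun x => div_nonneg (hf.im_nonneg (by rw [him]; exact hlpos)) hl0
  have hJc : Continuous J := by
    refine (Complex.continuous_im.comp (continuous_iff_continuousAt.2 fun x => ?_)).div_const _
    exact ContinuousAt.comp (f := fun x : ℝ => (x : ℂ) + l * Complex.I)
      (hf.continuousAt (by rw [him]; exact hlpos)) (by fun_prop)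
  have hJle : ∀ x ∈ Icc (τ - d) (τ + d), ENNReal.ofReal (J x) ≤ ENNReal.ofReal K +
      ∫⁻ t in I, ENNReal.ofReal ((x - t) ^ 2 + l ^ 2)⁻¹ ∂μ := fun x hx => by
    have := hJ (x + l * Complex.I) (by rw [him]; exact hlpos) (by
      calc ‖(x + l * Complex.I - τ : ℂ)‖ = ‖((x - τ : ℝ) : ℂ) + l * Complex.I‖ := by
            congr 1; push_cast; ring
        _ ≤ ‖((x - τ : ℝ) : ℂ)‖ + ‖(l : ℂ) * Complex.I‖ := norm_add_le _ _
        _ = |x - τ| + l := by simp [abs_of_pos hlpos, -Complex.ofReal_sub]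
        _ ≤ d + 2 * k * d / c := by
            gcongr
            exact abs_le.2 ⟨by linarith [hx.1], by linarith [hx.2]⟩
        _ ≤ r / 8 := hds)
    rwa [him, hre] at this
  have hker : ∀ t ∈ I, ∫⁻ x in Icc (τ - d) (τ + d), ENNReal.ofReal ((x - t) ^ 2 + l ^ 2)⁻¹ ≤
      ENNReal.ofReal (d * m) * (ENNReal.ofReal (γ (c * |t - τ|)))⁻¹ := fun t ht => by
    have htr : |t - τ| ≤ r := abs_le.2 ⟨by linarith [ht.1], by linarith [ht.2]⟩
    rcases lt_or_ge (2 * d) |t - τ| with h | h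
    · have h0 : 0 < |t - τ| := lt_trans (by positivity) h
      calc ∫⁻ x in Icc (τ - d) (τ + d), ENNReal.ofReal ((x - t) ^ 2 + l ^ 2)⁻¹
          ≤ ∫⁻ x in Icc (τ - d) (τ + d), ENNReal.ofReal (|t - τ| ^ 2 / 4)⁻¹ := by
            refine setLIntegral_mono' measurableSet_Icc fun x hx => ?_
            refine ENNReal.ofReal_le_ofReal (inv_sq_add_sq_le (lt_of_le_of_lt ?_ h))
            have : |x - τ| ≤ d := abs_le.2 ⟨by linarith [hx.1], by linarith [hx.2]⟩
            linarith
        _ = ENNReal.ofReal (|t - τ| ^ 2 / (8 * d))⁻¹ := by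
            rw [setLIntegral_const, Real.volume_Icc, ← ENNReal.ofReal_mul (by positivity)]
            congr 1
            field_simp
            ring
        _ ≤ _ := by
            refine ofReal_inv_le (by positivity) (by positivity) ?_
            calc γ (c * |t - τ|) ≤ k * |t - τ| ^ 2 := hkr _ h0 htr
              _ = d * (8 * k) * (|t - τ| ^ 2 / (8 * d)) := by field_simp
              _ ≤ d * m * (|t - τ| ^ 2 / (8 * d)) := by gcongr; exact le_max_left _ _
    · calc ∫⁻ x in Icc (τ - d) (τ + d), ENNReal.ofReal ((x - t) ^ 2 + l ^ 2)⁻¹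
          ≤ ∫⁻ x : ℝ, ENNReal.ofReal ((x - t) ^ 2 + l ^ 2)⁻¹ := setLIntegral_le_lintegral _ _
        _ = ENNReal.ofReal (l / π)⁻¹ := by
            rw [← ofReal_integral_eq_lintegral_ofReal (integrable_inv_sq_add_sq hlpos t)
              (Eventually.of_forall fun x => by positivity), integral_inv_sq_add_sq hlpos, inv_div]
        _ ≤ _ := by
            refine ofReal_inv_le (by positivity) (by positivity) ?_
            have h3 : γ (c * |t - τ|) ≤ γ (2 * c * d) := by
              refine hγm (by simp only [mem_Ici]; positivity) (by simp only [mem_Ici]; positivity) ?_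
              nlinarith
            calc γ (c * |t - τ|) ≤ γ (2 * c * d) := h3
              _ = d * (π * (2 * c)) * (l / π) := by rw [hl]; field_simp
              _ ≤ d * m * (l / π) := by gcongr; exact le_max_right _ _
  have hmeas : Measurable (Function.uncurry fun (x t : ℝ) =>
      ENNReal.ofReal ((x - t) ^ 2 + l ^ 2)⁻¹) := by
    unfold Function.uncurry
    fun_prop
  have hmain : ENNReal.ofReal (∫ x in Icc (τ - d) (τ + d), J x) ≤
      ENNReal.ofReal (2 * d * (K + m * A.toReal)) := by
    rw [ofReal_integral_eq_lintegral_ofReal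
      (hJc.continuousOn.integrableOn_compact isCompact_Icc) (Eventually.of_forall hJ0)]
    calc ∫⁻ x in Icc (τ - d) (τ + d), ENNReal.ofReal (J x)
        ≤ ∫⁻ x in Icc (τ - d) (τ + d), (ENNReal.ofReal K +
            ∫⁻ t in I, ENNReal.ofReal ((x - t) ^ 2 + l ^ 2)⁻¹ ∂μ) :=
          setLIntegral_mono' measurableSet_Icc hJle
      _ = ENNReal.ofReal K * ENNReal.ofReal (2 * d) + ∫⁻ t in I, (∫⁻ x in Icc (τ - d) (τ + d),
            ENNReal.ofReal ((x - t) ^ 2 + l ^ 2)⁻¹) ∂μ := by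
          rw [lintegral_add_left measurable_const, setLIntegral_const, Real.volume_Icc,
            lintegral_lintegral_swap hmeas.aemeasurable]
          congr 3
          ring
      _ ≤ ENNReal.ofReal K * ENNReal.ofReal (2 * d) + ENNReal.ofReal (d * m) * A := by
          gcongr
          rw [← lintegral_const_mul' _ _ ENNReal.ofReal_ne_top]
          exact setLIntegral_mono' measurableSet_Icc hker
      _ = ENNReal.ofReal (K * (2 * d) + d * m * A.toReal) := by
          rw [ENNReal.ofReal_add (by positivity) (by positivity), ENNReal.ofReal_mul hK,
            ENNReal.ofReal_mul (q := A.toReal) (by positivity), ENNReal.ofReal_toReal hA.ne]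
      _ ≤ _ := by
          refine ENNReal.ofReal_le_ofReal ?_
          have : 0 ≤ d * m * A.toReal := by positivity
          linarith
  exact (ENNReal.ofReal_le_ofReal_iff (by positivity)).1 hmain

/-- The quotient at `d` depends on the rate only through its value at `d`, so for each `d` the
minimum agrees with one of the two rates. -/
theorem exists_amortizedJuliaQuotient_min_le {lam lam' : ℝ → ℝ}
    (h : ∃ M : ℝ, ∀ᶠ d in 𝓝[>] (0 : ℝ),
      amortizedJuliaQuotient halfPlane halfPlane f lam τ d ≤ M)
    (h' : ∃ M : ℝ, ∀ᶠ d in 𝓝[>] (0 : ℝ),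
      amortizedJuliaQuotient halfPlane halfPlane f lam' τ d ≤ M) :
    ∃ M : ℝ, ∀ᶠ d in 𝓝[>] (0 : ℝ),
      amortizedJuliaQuotient halfPlane halfPlane f (fun t => min (lam t) (lam' t)) τ d ≤ M := by
  obtain ⟨M, hM⟩ := h
  obtain ⟨M', hM'⟩ := h'
  refine ⟨max M M', ?_⟩
  filter_upwards [hM, hM'] with d h1 h2
  rcases le_total (lam d) (lam' d) with hle | hle
  · rw [amortizedJuliaQuotient_congr (lam := fun t => min (lam t) (lam' t)) (lam' := lam)
      (min_eq_left hle)]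
    exact h1.trans (le_max_left _ _)
  · rw [amortizedJuliaQuotient_congr (lam := fun t => min (lam t) (lam' t)) (lam' := lam')
      (min_eq_right hle)]
    exact h2.trans (le_max_right _ _)

end

/-! ### Pick functions built from point masses -/

/-- The Pick function `∑ mₙ / (pₙ - z)` with point masses `mₙ` at the points `pₙ`. -/
def pickSum (m p : ℕ → ℝ) (z : ℂ) : ℂ := ∑' n, (m n : ℂ) / ((p n : ℂ) - z)

/-- The Nevanlinna measure of `pickSum m p`. -/
def poleMeasure (m p : ℕ → ℝ) : Measure ℝ :=
  Measure.sum fun n => ENNReal.ofReal (π * m n) • Measure.dirac (p n)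

theorem norm_div_ofReal_sub_le {m : ℝ} (hm : 0 ≤ m) (p : ℝ) {η : ℝ} (hη : 0 < η) {z : ℂ}
    (hz : η ≤ z.im) : ‖(m : ℂ) / ((p : ℂ) - z)‖ ≤ m / η := by
  rw [norm_div, Complex.norm_real, Real.norm_eq_abs, abs_of_nonneg hm]
  have : η ≤ ‖(p : ℂ) - z‖ := by
    have h := Complex.abs_im_le_norm ((p : ℂ) - z)
    rw [Complex.sub_im, Complex.ofReal_im, zero_sub, abs_neg] at h
    exact (hz.trans (le_abs_self _)).trans h
  gcongr

theorem im_div_ofReal_sub (m p : ℝ) (z : ℂ) :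
    ((m : ℂ) / ((p : ℂ) - z)).im = m * (z.im * ((z.re - p) ^ 2 + z.im ^ 2)⁻¹) := by
  rw [Complex.div_im, Complex.normSq_apply]
  simp only [Complex.ofReal_im, Complex.ofReal_re, Complex.sub_re, Complex.sub_im]
  rw [show (p - z.re) * (p - z.re) + (0 - z.im) * (0 - z.im) = (z.re - p) ^ 2 + z.im ^ 2 by ring]
  ring

section

variable {m p : ℕ → ℝ}

theorem hasSum_pickSum (hm0 : ∀ n, 0 ≤ m n) (hm : Summable m) {z : ℂ} (hz : 0 < z.im) :
    HasSum (fun n => (m n : ℂ) / ((p n : ℂ) - z)) (pickSum m p z) :=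
  (Summable.of_norm_bounded (hm.div_const z.im)
    fun n => norm_div_ofReal_sub_le (hm0 n) _ hz le_rfl).hasSum

theorem hasSum_im_pickSum (hm0 : ∀ n, 0 ≤ m n) (hm : Summable m) {z : ℂ} (hz : 0 < z.im) :
    HasSum (fun n => m n * (z.im * ((z.re - p n) ^ 2 + z.im ^ 2)⁻¹)) (pickSum m p z).im := by
  have := Complex.imCLM.hasSum (hasSum_pickSum (p := p) hm0 hm hz)
  simpa only [Complex.imCLM_apply, im_div_ofReal_sub, Function.comp_def] using! this

theorem isPick_pickSum (hm0 : ∀ n, 0 ≤ m n) (hm : Summable m) : IsPick (pickSum m p) where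
  analytic z hz := by
    have hz : 0 < z.im := hz
    have ho : IsOpen {w : ℂ | z.im / 2 < w.im} := isOpen_lt continuous_const Complex.continuous_im
    have : DifferentiableOn ℂ (pickSum m p) {w : ℂ | z.im / 2 < w.im} := by
      refine Complex.differentiableOn_tsum_of_summable_norm (hm.div_const (z.im / 2)) ?_ ho ?_
      · intro n w hw
        have hw : z.im / 2 < w.im := hw
        refine DifferentiableAt.differentiableWithinAt ?_
        refine (differentiableAt_const _).div (by fun_prop) fun h => ?_
        have := congrArg Complex.im h
        simp at this
        linarith
      · intro n w hw
        exact norm_div_ofReal_sub_le (hm0 n) _ (half_pos hz) (le_of_lt hw)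
    exact this.analyticAt (ho.mem_nhds (half_lt_self hz))
  mapsTo z hz := by
    have hz : 0 < z.im := hz
    rw [closure_halfPlane]
    refine (hasSum_im_pickSum hm0 hm hz).nonneg fun n => ?_
    have := hm0 n
    positivity

/-- The substitution `x = y s + a` moves the dependence on `y` from the kernel into `g`, leaving a
fixed integrable weight of mass `π`. -/
theorem integral_mul_inv_sq_add_sq (g : ℝ → ℝ) (a : ℝ) {y : ℝ} (hy : 0 < y) :
    ∫ x, g x * (y * ((x - a) ^ 2 + y ^ 2)⁻¹) = ∫ s, g (y * s + a) * (1 + s ^ 2)⁻¹ := by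
  have h1 : ∀ s, g (y * s + a) * (1 + s ^ 2)⁻¹ =
      y * (g (y * s + a) * (y * ((y * s + a - a) ^ 2 + y ^ 2)⁻¹)) := fun s => by
    rw [inv_sq_add_sq_eq hy, add_sub_cancel_right, mul_div_cancel_left₀ s hy.ne']
    field_simp
  simp only [h1]
  rw [integral_const_mul, Measure.integral_comp_mul_left
    (fun u => g (u + a) * (y * ((u + a - a) ^ 2 + y ^ 2)⁻¹)) y,
    integral_add_right_eq_self (fun x => g x * (y * ((x - a) ^ 2 + y ^ 2)⁻¹)),
    abs_of_pos (inv_pos.2 hy), smul_eq_mul, mul_inv_cancel_left₀ hy.ne']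

theorem abs_integral_mul_inv_le {g : ℝ → ℝ} {G : ℝ} (hG : ∀ x, |g x| ≤ G) (y a : ℝ) :
    |∫ s, g (y * s + a) * (1 + s ^ 2)⁻¹| ≤ G * π := by
  rw [← integral_univ_inv_one_add_sq, ← integral_const_mul, ← Real.norm_eq_abs]
  refine norm_integral_le_of_norm_le (integrable_inv_one_add_sq.const_mul G)
    (Eventually.of_forall fun s => ?_)
  rw [norm_mul, Real.norm_eq_abs, Real.norm_of_nonneg (by positivity)]
  exact mul_le_mul_of_nonneg_right (hG _) (by positivity)

theorem tendsto_integral_mul_inv {g : ℝ → ℝ} (hg : Continuous g) {G : ℝ} (hG : ∀ x, |g x| ≤ G)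
    (a : ℝ) : Tendsto (fun y : ℝ => ∫ s, g (y * s + a) * (1 + s ^ 2)⁻¹) (𝓝[>] 0)
      (𝓝 (π * g a)) := by
  have hlim : π * g a = ∫ s : ℝ, g a * (1 + s ^ 2)⁻¹ := by
    rw [integral_const_mul, integral_univ_inv_one_add_sq, mul_comm]
  rw [hlim]
  have hinv : Continuous fun s : ℝ => (1 + s ^ 2)⁻¹ :=
    Continuous.inv₀ (by fun_prop) fun s => by positivity
  refine tendsto_integral_filter_of_dominated_convergence (fun s => G * (1 + s ^ 2)⁻¹) ?_ ?_
    (integrable_inv_one_add_sq.const_mul G) ?_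
  · exact Eventually.of_forall fun y =>
      ((hg.comp (by fun_prop)).mul hinv).aestronglyMeasurable
  · refine Eventually.of_forall fun y => Eventually.of_forall fun s => ?_
    rw [norm_mul, Real.norm_eq_abs, Real.norm_of_nonneg (by positivity)]
    exact mul_le_mul_of_nonneg_right (hG _) (by positivity)
  · refine Eventually.of_forall fun s => Tendsto.mul_const _ ?_
    have : Tendsto (fun y : ℝ => g (y * s + a)) (𝓝 0) (𝓝 (g (0 * s + a))) :=
      Continuous.tendsto (hg.comp (by fun_prop)) 0
    rw [zero_mul, zero_add] at this
    exact this.mono_left nhdsWithin_le_nhds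

theorem isFiniteMeasure_poleMeasure (hm : Summable m) : IsFiniteMeasure (poleMeasure m p) := by
  refine ⟨?_⟩
  rw [poleMeasure, Measure.sum_apply _ MeasurableSet.univ]
  simp only [Measure.smul_apply, measure_univ, smul_eq_mul, mul_one]
  exact (hm.mul_left π).tsum_ofReal_lt_top

/-- Each pole yields a Poisson kernel converging to `π` times a point mass. The bound `G * π` is
uniform in the pole and in `y`, so summability of the masses justifies exchanging sum with integral
and sum with limit. -/
theorem isNevanlinnaMeasure_pickSum (hm0 : ∀ n, 0 ≤ m n) (hm : Summable m) :
    IsNevanlinnaMeasure (pickSum m p) (poleMeasure m p) := by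
  have hfin := isFiniteMeasure_poleMeasure (p := p) hm
  refine ⟨inferInstance, fun g hg hgs => ?_⟩
  obtain ⟨G, hG⟩ := hgs.exists_bound_of_continuous hg
  have hG : ∀ x, |g x| ≤ G := hG
  have hgint : Integrable g (poleMeasure m p) :=
    Integrable.of_bound hg.aestronglyMeasurable G (Eventually.of_forall hG)
  have hμ : ∫ x, g x ∂(poleMeasure m p) = ∑' n, m n * (π * g (p n)) := by
    rw [poleMeasure] at hgint ⊢
    rw [integral_sum_measure hgint]
    congr 1
    funext n
    rw [integral_smul_measure, integral_dirac,
      ENNReal.toReal_ofReal (mul_nonneg pi_pos.le (hm0 n)), smul_eq_mul]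
    ring
  rw [hμ]
  have hsum : ∀ᶠ y : ℝ in 𝓝[>] 0,
      ∑' n, m n * ∫ s, g (y * s + p n) * (1 + s ^ 2)⁻¹ =
        ∫ x : ℝ, g x * (pickSum m p (x + y * Complex.I)).im := by
    filter_upwards [self_mem_nhdsWithin] with y hy
    have hy : 0 < y := hy
    have hkint : ∀ a, Integrable fun x => g x * (y * ((x - a) ^ 2 + y ^ 2)⁻¹) := fun a =>
      ((integrable_inv_sq_add_sq hy a).const_mul y).bdd_mul hg.aestronglyMeasurable
        (Eventually.of_forall hG)
    have habs : ∀ a, ∫ x, ‖g x * (y * ((x - a) ^ 2 + y ^ 2)⁻¹)‖ ≤ G * π := fun a => by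
      have h1 : ∀ x, ‖g x * (y * ((x - a) ^ 2 + y ^ 2)⁻¹)‖ =
          |g x| * (y * ((x - a) ^ 2 + y ^ 2)⁻¹) := fun x => by
        rw [norm_mul, Real.norm_eq_abs, Real.norm_of_nonneg (by positivity)]
      simp only [h1]
      rw [integral_mul_inv_sq_add_sq (fun x => |g x|) a hy]
      exact (le_abs_self _).trans
        (abs_integral_mul_inv_le (g := fun x => |g x|) (fun x => by rw [abs_abs]; exact hG x) y a)
    have hS := hasSum_integral_of_summable_integral_norm (μ := volume)
      (F := fun n x => m n * (g x * (y * ((x - p n) ^ 2 + y ^ 2)⁻¹)))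
      (fun n => (hkint _).const_mul _) (by
        refine Summable.of_nonneg_of_le (fun n => integral_nonneg fun x => norm_nonneg _)
          (fun n => ?_) (hm.mul_right (G * π))
        simp only [norm_mul (m n), Real.norm_of_nonneg (hm0 n)]
        rw [integral_const_mul]
        exact mul_le_mul_of_nonneg_left (habs _) (hm0 n))
    simp only [integral_const_mul, integral_mul_inv_sq_add_sq g _ hy] at hS
    rw [hS.tsum_eq]
    congr 1
    funext x
    have h2 := (hasSum_im_pickSum (p := p) hm0 hm
      (z := x + y * Complex.I) (by simpa using hy)).mul_left (g x)
    simp only [Complex.add_im, Complex.add_re, Complex.ofReal_re, Complex.ofReal_im,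
      Complex.re_ofReal_mul, Complex.im_ofReal_mul, Complex.I_re, Complex.I_im, mul_zero, mul_one,
      zero_add, add_zero] at h2
    rw [← h2.tsum_eq]
    congr 1
    funext n
    ring
  refine Tendsto.congr' hsum ?_
  refine tendsto_tsum_of_dominated_convergence (hm.mul_right (G * π))
    (fun n => (tendsto_integral_mul_inv hg hG (p n)).const_mul (m n))
    (Eventually.of_forall fun y n => ?_)
  rw [norm_mul, Real.norm_of_nonneg (hm0 n)]
  exact mul_le_mul_of_nonneg_left (abs_integral_mul_inv_le hG _ _) (hm0 n)

/-- All terms of the imaginary part are nonnegative, so the pole directly below the point gives a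
lower bound by itself. -/
theorem le_juliaQuotient_pickSum (hm0 : ∀ n, 0 ≤ m n) (hm : Summable m) (n : ℕ) {y : ℝ}
    (hy : 0 < y) :
    m n / y ^ 2 ≤ juliaQuotient halfPlane halfPlane (pickSum m p) (p n + y * Complex.I) := by
  have him : ((p n : ℂ) + y * Complex.I).im = y := by simp
  have hre : ((p n : ℂ) + y * Complex.I).re = p n := by simp
  rw [juliaQuotient_halfPlane (isPick_pickSum hm0 hm) (by rw [him]; exact hy), him]
  have h := le_hasSum (hasSum_im_pickSum (p := p) hm0 hm
    (z := p n + y * Complex.I) (by rw [him]; exact hy)) n (fun j _ => by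
      have := hm0 j
      rw [him]
      positivity)
  rw [him, hre, sub_self] at h
  rw [le_div_iff₀ hy]
  refine le_trans (le_of_eq ?_) h
  field_simp
  ring

end

/-! ### Sharpness of the square-root rate -/

/-- Sharpness: for every rate `lam` below a square-root rate there is a regular Pick function built
from point masses whose Julia quotient is unbounded on the `lam`-Stolz region. -/
theorem exists_isRegularAt_frequently_lt {γ : ℝ → ℝ} (τ : ℝ)
    (hγ : γ =O[𝓝[>] (0 : ℝ)] fun t : ℝ => t ^ 2) (hγpos : ∀ t : ℝ, 0 < t → 0 < γ t)
    {lam : ℝ → ℝ} {B C : ℝ} (hB : 0 < B) (hC : 0 < C)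
    (hlam : lam =o[𝓝[>] (0 : ℝ)] fun t => √(B * γ (C * t))) :
    ∃ f : ℂ → ℂ, IsPick f ∧ IsRegularAt γ τ f ∧
      (∃ m p : ℕ → ℝ, (∀ n, 0 < m n) ∧ Summable m ∧
        ∀ z ∈ halfPlane, HasSum (fun n => (m n : ℂ) / ((p n : ℂ) - z)) (f z)) ∧
      ∀ M : ℝ, ∃ᶠ z in 𝓝[stolzRegion halfPlane lam τ] (τ : ℂ),
        M < juliaQuotient halfPlane halfPlane f z := by
  have hγlim : Tendsto (fun t => γ (C * t)) (𝓝[>] 0) (𝓝 0) := by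
    have h1 : Tendsto γ (𝓝[>] 0) (𝓝 0) := by
      refine hγ.trans_tendsto ?_
      have : Tendsto (fun t : ℝ => t ^ 2) (𝓝 0) (𝓝 (0 ^ 2)) := Continuous.tendsto (by fun_prop) 0
      rw [zero_pow two_ne_zero] at this
      exact this.mono_left nhdsWithin_le_nhds
    refine h1.comp (tendsto_nhdsWithin_iff.2 ⟨?_, ?_⟩)
    · have : Tendsto (fun t : ℝ => C * t) (𝓝 0) (𝓝 (C * 0)) := Continuous.tendsto (by fun_prop) 0
      rw [mul_zero] at this
      exact this.mono_left nhdsWithin_le_nhds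
    · filter_upwards [self_mem_nhdsWithin] with t ht
      exact mul_pos hC ht
  -- The little-o hypothesis is used with constant `2⁻ⁿ`. The bound `t ≤ 2⁻ⁿ` sends the poles to
  -- `τ`, and `γ (C * t) ≤ 1` makes the masses summable and the heights tend to `0`.
  have hex : ∀ n : ℕ, ∃ t : ℝ, 0 < t ∧ t ≤ (1 / 2 : ℝ) ^ n ∧ γ (C * t) ≤ 1 ∧
      lam t ≤ (1 / 2 : ℝ) ^ n * √(B * γ (C * t)) := fun n => by
    have hev := hlam.bound (show (0 : ℝ) < (1 / 2) ^ n by positivity)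
    obtain ⟨t, ⟨h3, h4⟩, h2⟩ := (((hγlim.eventually_le_const one_pos).and hev).and
      (Ioc_mem_nhdsGT (show (0 : ℝ) < (1 / 2) ^ n by positivity))).exists
    refine ⟨t, h2.1, h2.2, h3, (le_abs_self _).trans ?_⟩
    rwa [Real.norm_eq_abs, Real.norm_of_nonneg (Real.sqrt_nonneg _)] at h4
  choose t ht0 ht hγ1 hlt using hex
  have hg : ∀ n, 0 < γ (C * t n) := fun n => hγpos _ (mul_pos hC (ht0 n))
  set m : ℕ → ℝ := fun n => (1 / 2) ^ n * γ (C * t n) with hmdef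
  set p : ℕ → ℝ := fun n => τ + t n with hpdef
  have hm0 : ∀ n, 0 < m n := fun n => mul_pos (by positivity) (hg n)
  have hm : Summable m := Summable.of_nonneg_of_le (fun n => (hm0 n).le)
    (fun n => mul_le_of_le_one_right (by positivity) (hγ1 n)) summable_geometric_two
  set y : ℕ → ℝ := fun n => (1 / 2) ^ n * √(B * γ (C * t n)) with hydef
  have hy0 : ∀ n, 0 < y n := fun n =>
    mul_pos (by positivity) (Real.sqrt_pos.2 (mul_pos hB (hg n)))
  have hpow : Tendsto (fun n : ℕ => (1 / 2 : ℝ) ^ n) atTop (𝓝 0) :=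
    tendsto_pow_atTop_nhds_zero_of_lt_one (by norm_num) (by norm_num)
  refine ⟨pickSum m p, isPick_pickSum (fun n => (hm0 n).le) hm, ?_,
    ⟨m, p, hm0, hm, fun z hz => hasSum_pickSum (fun n => (hm0 n).le) hm hz⟩, fun M => ?_⟩
  · refine ⟨poleMeasure m p, isNevanlinnaMeasure_pickSum (fun n => (hm0 n).le) hm, C, hC, univ,
      univ_mem, ?_⟩
    rw [Measure.restrict_univ, poleMeasure, lintegral_sum_measure]
    -- The factor `γ (C * t n)` in the mass cancels the integrand at the pole.
    have hterm : ∀ n, ∫⁻ s, (ENNReal.ofReal (γ (C * |s - τ|)))⁻¹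
        ∂(ENNReal.ofReal (π * m n) • Measure.dirac (p n)) =
          ENNReal.ofReal (π * (1 / 2) ^ n) := fun n => by
      rw [lintegral_smul_measure, lintegral_dirac, smul_eq_mul, hpdef]
      simp only [add_sub_cancel_left, abs_of_pos (ht0 n)]
      rw [← ENNReal.ofReal_inv_of_pos (hg n),
        ← ENNReal.ofReal_mul (mul_nonneg pi_pos.le (hm0 n).le), hmdef]
      congr 1
      have := (hg n).ne'
      field_simp
    simp only [hterm]
    exact (summable_geometric_two.mul_left π).tsum_ofReal_lt_top
  · have hylim : Tendsto y atTop (𝓝 0) := by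
      refine squeeze_zero (fun n => (hy0 n).le) (fun n => ?_) (g := fun n => (1 / 2) ^ n * √B) ?_
      · refine mul_le_mul_of_nonneg_left (Real.sqrt_le_sqrt ?_) (by positivity)
        exact mul_le_of_le_one_right hB.le (hγ1 n)
      · simpa using hpow.mul_const √B
    have hplim : Tendsto p atTop (𝓝 τ) := by
      have := (squeeze_zero (fun n => (ht0 n).le) ht hpow).const_add τ
      rwa [add_zero] at this
    have hzlim : Tendsto (fun n => (p n + y n * Complex.I : ℂ)) atTop
        (𝓝[stolzRegion halfPlane lam τ] (τ : ℂ)) := by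
      refine tendsto_nhdsWithin_iff.2 ⟨?_, Eventually.of_forall fun n => ?_⟩
      · have := ((Complex.continuous_ofReal.tendsto _).comp hplim).add
          (((Complex.continuous_ofReal.tendsto _).comp hylim).mul_const Complex.I)
        simpa using! this
      · rw [mem_stolzRegion_halfPlane]
        have him : ((p n : ℂ) + y n * Complex.I).im = y n := by simp
        have hre : ((p n : ℂ) + y n * Complex.I).re = p n := by simp
        rw [him, hre]
        refine ⟨hy0 n, t n, ht0 n, hlt n, ?_⟩
        rw [hpdef]
        simp only [add_sub_cancel_left, abs_of_pos (ht0 n), le_refl]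
    refine hzlim.frequently (Eventually.frequently ?_)
    have hbig : Tendsto (fun n : ℕ => (2 : ℝ) ^ n / B) atTop atTop :=
      (tendsto_pow_atTop_atTop_of_one_lt (by norm_num)).atTop_div_const hB
    filter_upwards [hbig.eventually_gt_atTop M] with n hn
    refine hn.trans_le (le_trans (le_of_eq ?_)
      (le_juliaQuotient_pickSum (fun n => (hm0 n).le) hm n (hy0 n)))
    -- Squaring the height produces `4⁻ⁿ` against the `2⁻ⁿ` of the mass; the surplus `2ⁿ` makes the
    -- quotient unbounded.
    have hsq : y n ^ 2 = (1 / 2) ^ n * (1 / 2) ^ n * (B * γ (C * t n)) := by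
      rw [hydef]
      simp only [mul_pow]
      rw [Real.sq_sqrt (mul_pos hB (hg n)).le, sq]
    have := (hg n).ne'
    rw [hsq, hmdef]
    simp only [one_div, inv_pow]
    field_simp

end PickJulia

end

theorem mainTheorem2 (γ : ℝ → ℝ) (τ : ℝ)
    (hγ_nonneg : ∀ t : ℝ, 0 ≤ t → 0 ≤ γ t)
    (hγ_mono : MonotoneOn γ (Set.Ici 0))
    (hγ_bigO : γ =O[𝓝[>] (0 : ℝ)] fun t : ℝ => t ^ 2) :
    -- the Julia quotient is bounded on Stolz regions of square-root type
    (∀ f : ℂ → ℂ, PickJulia.IsPick f → PickJulia.IsRegularAt γ τ f →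
      ∃ C : ℝ, 0 < C ∧ ∀ D : ℝ, 0 < D → ∃ M : ℝ,
        ∀ᶠ z in 𝓝[PickJulia.stolzRegion PickJulia.halfPlane (fun t => √(D * γ (C * t))) τ] (τ : ℂ),
          PickJulia.juliaQuotient PickJulia.halfPlane PickJulia.halfPlane f z ≤ M) ∧
    -- the amortized Julia quotient is bounded, and it stays so for the minimum with any other rate
    (∀ f : ℂ → ℂ, PickJulia.IsPick f → PickJulia.IsRegularAt γ τ f →
      ∃ C : ℝ, 0 < C ∧
        (∃ M : ℝ, ∀ᶠ d in 𝓝[>] (0 : ℝ),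
          PickJulia.amortizedJuliaQuotient PickJulia.halfPlane PickJulia.halfPlane f
            (fun t => γ (C * t) / (C * t)) τ d ≤ M) ∧
        (∀ lam : ℝ → ℝ, (∀ t : ℝ, 0 ≤ t → 0 ≤ lam t) →
          (∃ M : ℝ, ∀ᶠ d in 𝓝[>] (0 : ℝ),
            PickJulia.amortizedJuliaQuotient PickJulia.halfPlane PickJulia.halfPlane f
              lam τ d ≤ M) →
          ∃ M : ℝ, ∀ᶠ d in 𝓝[>] (0 : ℝ),
            PickJulia.amortizedJuliaQuotient PickJulia.halfPlane PickJulia.halfPlane f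
              (fun t => min (γ (C * t) / (C * t)) (lam t)) τ d ≤ M)) ∧
    -- sharpness: a regular function built from point masses with unbounded Julia quotient
    ((∀ t : ℝ, 0 < t → 0 < γ t) →
      ∀ lam : ℝ → ℝ, (∀ t : ℝ, 0 ≤ t → 0 ≤ lam t) →
        (∃ B C : ℝ, 0 < B ∧ 0 < C ∧ lam =o[𝓝[>] (0 : ℝ)] fun t => √(B * γ (C * t))) →
        ∃ f : ℂ → ℂ, PickJulia.IsPick f ∧ PickJulia.IsRegularAt γ τ f ∧
          (∃ m p : ℕ → ℝ, (∀ n, 0 < m n) ∧ Summable m ∧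
            ∀ z ∈ PickJulia.halfPlane, HasSum (fun n => (m n : ℂ) / ((p n : ℂ) - z)) (f z)) ∧
          ∀ M : ℝ, ∃ᶠ z in 𝓝[PickJulia.stolzRegion PickJulia.halfPlane lam τ] (τ : ℂ),
            M < PickJulia.juliaQuotient PickJulia.halfPlane PickJulia.halfPlane f z) := by
  refine ⟨fun f hf hreg => hreg.exists_juliaQuotient_le hγ_mono hγ_bigO hf, fun f hf hreg => ?_,
    fun hγpos lam _ ⟨B, C, hB, hC, hlam⟩ =>
      PickJulia.exists_isRegularAt_frequently_lt τ hγ_bigO hγpos hB hC hlam⟩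
  obtain ⟨C, hC, hM⟩ := hreg.exists_amortizedJuliaQuotient_le hγ_nonneg hγ_mono hγ_bigO hf
  exact ⟨C, hC, hM, fun lam _ hlam => PickJulia.exists_amortizedJuliaQuotient_min_le hM hlam⟩
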